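/- Let $\gamma\in\mathbb R$ and let $V\in C^\infty([0,\infty))$ be real-valued such that, for some $\rho\in(1,2]$ and constants $C_j$, $|V^{(j)}(x)|\le C_j(1+x)^{-\rho-j}$ for all $x\ge 0$ and $j\in\mathbb N_0$. Let $H_0=-\frac{d^2}{dx^2}$ on $L_2(0,\infty)$ with boundary condition $u'(0)=\gamma u(0)$; its resolvent $R_0(\zeta^2)=(H_0-\zeta^2)^{-1}$ has the kernel $$R_0(x,y;\zeta^2)=R_0(y,x;\zeta^2)=\frac{\big((\gamma+i\zeta)e^{i\zeta x}-(\gamma-i\zeta)e^{-i\zeta x}\big)e^{i\zeta y}}{2i\zeta(\gamma-i\zeta)},\qquad x\le y .$$ Let $D(\zeta)=\det\big(1+\sqrt V\,R_0(\zeta^2)\sqrt{|V|}\big)$, with $\sqrt V:=(\operatorname{sgn}V)\sqrt{|V|}$, be the perturbation determinant, i.e. the Fredholm determinant $\sum_{n\ge0}\frac1{n!}\int_{[0,\infty)^n}\det\big(K_\zeta(x_i,x_j)\big)_{i,j=1}^n\,dx$ of the kernel $K_\zeta(x,y)=\sqrt{V(x)}\,R_0(x,y;\zeta^2)\sqrt{|V(y)|}$.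 It is considered for all large $|\zeta|$ with $\operatorname{Im}\zeta\ge0$; for real $\zeta$ the kernel $R_0$ above is the boundary value of the resolvent kernel. Define $b_0(x)=1$, $b_{n+1}(x)=-b_n'(x)-\int_x^\infty V(y)b_n(y)\,dy$ for $x\ge0$, and $$d_0=1,\qquad d_n=b_n(0)+2\sum_{m=1}^{n-1}b_m'(0)(2\gamma)^{n-m-1}\quad(n\ge1),$$ $$\ell_1=d_1,\qquad \ell_n=d_n-\frac1n\sum_{j=1}^{n-1}j\,d_{n-j}\,\ell_j\quad(n\ge2).$$ Then, as $|\zeta|\to\infty$ with $\operatorname{Im}\zeta\ge0$, $D(\zeta)=\sum_{n=0}^\infty d_n(2i\zeta)^{-n}$ in the sense of an asymptotic series, i.e. for every $N\ge0$ $$D(\zeta)-\sum_{n=0}^N d_n(2i\zeta)^{-n}=O(|\zeta|^{-N-1}).$$ Consequently $\ln D(\zeta)$, with the branch fixed by $\ln D(\zeta)\to0$ as $|\zeta|\to\infty$, exists for large $|\zeta|$, $\operatorname{Im}\zeta\ge0$, and has in the same sense the asymptotic expansion $$\ln D(\zeta)=\sum_{n=1}^\infty \ell_n(2i\zeta)^{-n}.$$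 -/

import Mathlib

noncomputable section

namespace RobinHalfLine

open MeasureTheory

/-- The Fredholm determinant `det (1 + K)` of the integral operator with kernel `K` on
`L²(μ)`, through Fredholm's series
`∑ₙ (1/n!) ∫ ⋯ ∫ det (K (xᵢ, xⱼ))_{i,j < n} dμ(x₀) ⋯ dμ(xₙ₋₁)`. -/
def fredholmDet (μ : Measure ℝ) (K : ℝ → ℝ → ℂ) : ℂ :=
  ∑' n : ℕ, ((n.factorial : ℕ) : ℂ)⁻¹ *
    ∫ x : Fin n → ℝ, (Matrix.of fun i j : Fin n => K (x i) (x j)).det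
      ∂(Measure.pi fun _ : Fin n => μ)

/-- The solution of `-u'' = ζ² u` with `u(0) = 1`, `u'(0) = γ`. -/
def freeRegular (γ : ℝ) (ζ : ℂ) (x : ℝ) : ℂ :=
  (((γ : ℂ) + Complex.I * ζ) * Complex.exp (Complex.I * ζ * x)
    - ((γ : ℂ) - Complex.I * ζ) * Complex.exp (-(Complex.I * ζ * x))) / (2 * Complex.I * ζ)

/-- The integral kernel of the free resolvent `R₀(z) = (H₀ - z)⁻¹`, `z = ζ²`, where
`H₀ = -d²/dx²` on `L²(0, ∞)` with boundary condition `u'(0) = γ u(0)`. For `x ≤ y` it is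
`φ₀(x) e^{iζy} / (γ - iζ)` and it is symmetric in `x, y`. For real `ζ ≠ 0` this is the kernel of
the boundary value of the resolvent on the real axis. -/
def freeResolventKernel (γ : ℝ) (ζ : ℂ) (x y : ℝ) : ℂ :=
  freeRegular γ ζ (min x y) * Complex.exp (Complex.I * ζ * (max x y : ℝ)) /
    ((γ : ℂ) - Complex.I * ζ)

/-- The kernel of `√V R₀(ζ²) √|V|`, where `√V := (sgn V) √|V|`. -/
def sandwichKernel (γ : ℝ) (V : ℝ → ℝ) (ζ : ℂ) (x y : ℝ) : ℂ :=
  ((Real.sign (V x) * Real.sqrt |V x| : ℝ) : ℂ) * freeResolventKernel γ ζ x y *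
    ((Real.sqrt |V y| : ℝ) : ℂ)

/-- The perturbation determinant `D(ζ) = det (1 + √V R₀(ζ²) √|V|)` on `L²(0, ∞)`. -/
def perturbationDet (γ : ℝ) (V : ℝ → ℝ) (ζ : ℂ) : ℂ :=
  fredholmDet (volume.restrict (Set.Ici (0 : ℝ))) (sandwichKernel γ V ζ)

/-- `b₀ = 1`, `bₙ₊₁(x) = -bₙ'(x) - ∫ₓ^∞ V bₙ`, functions on `[0, ∞)`
(the derivative at `0` is one-sided). -/
def jostCoeff (V : ℝ → ℝ) : ℕ → ℝ → ℝ
  | 0 => fun _ => 1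
  | n + 1 => fun x =>
      -derivWithin (jostCoeff V n) (Set.Ici 0) x - ∫ y in Set.Ioi x, V y * jostCoeff V n y

/-- `d₀ = 1`, `dₙ = bₙ(0) + 2 ∑_{m=1}^{n-1} bₘ'(0) (2γ)^{n-m-1}` for `n ≥ 1`. -/
def detCoeff (γ : ℝ) (V : ℝ → ℝ) (n : ℕ) : ℝ :=
  if n = 0 then 1 else
    jostCoeff V n 0 + 2 * ∑ m ∈ Finset.Ico 1 n,
      derivWithin (jostCoeff V m) (Set.Ici 0) 0 * (2 * γ) ^ (n - m - 1)

/-- `ℓₙ = dₙ - n⁻¹ ∑_{j=1}^{n-1} j dₙ₋ⱼ ℓⱼ` for `n ≥ 1` (so `ℓ₁ = d₁`); the value at `0` is not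
used. -/
def logDetCoeff (γ : ℝ) (V : ℝ → ℝ) (n : ℕ) : ℝ :=
  detCoeff γ V n - (n : ℝ)⁻¹ * ∑ j ∈ (Finset.Ico 1 n).attach,
    (j.1 : ℝ) * detCoeff γ V (n - j.1) * logDetCoeff γ V j.1
termination_by n
decreasing_by exact (Finset.mem_Ico.mp j.2).2

theorem logDetCoeff_eq (γ : ℝ) (V : ℝ → ℝ) (n : ℕ) :
    logDetCoeff γ V n = detCoeff γ V n - (n : ℝ)⁻¹ * ∑ j ∈ Finset.Ico 1 n,
      (j : ℝ) * detCoeff γ V (n - j) * logDetCoeff γ V j := by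
  rw [logDetCoeff, ← Finset.sum_attach (Finset.Ico 1 n)]

theorem logDetCoeff_one (γ : ℝ) (V : ℝ → ℝ) : logDetCoeff γ V 1 = detCoeff γ V 1 := by
  rw [logDetCoeff_eq]; simp

/-- The filter `|ζ| → ∞`, `Im ζ ≥ 0`. -/
def upperInfinity : Filter ℂ :=
  Bornology.cobounded ℂ ⊓ Filter.principal {ζ : ℂ | 0 ≤ ζ.im}

/-- `f(ζ) = ∑ₙ aₙ (2iζ)⁻ⁿ` as an asymptotic series for `|ζ| → ∞`, `Im ζ ≥ 0`: for every `N`,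
`f(ζ) - ∑_{n=0}^N aₙ (2iζ)⁻ⁿ = O(|ζ|^{-N-1})`. -/
def HasAsymptoticSeries (f : ℂ → ℂ) (a : ℕ → ℝ) : Prop :=
  ∀ N : ℕ, Asymptotics.IsBigO upperInfinity
    (fun ζ : ℂ => f ζ - ∑ n ∈ Finset.range (N + 1), (a n : ℂ) * ((2 * Complex.I * ζ) ^ n)⁻¹)
    (fun ζ : ℂ => (‖ζ‖ ^ (N + 1))⁻¹)

/-- `L` is a logarithm of `D` for large `|ζ|`, `Im ζ ≥ 0`, with branch fixed by `L(ζ) → 0` as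
`|ζ| → ∞`. -/
def IsLogAtInfinity (D L : ℂ → ℂ) : Prop :=
  (∀ᶠ ζ in upperInfinity, Complex.exp (L ζ) = D ζ) ∧
    Filter.Tendsto L upperInfinity (nhds 0)

end RobinHalfLine

end

/-!
Put `z = 2iζ` and `c = (γ + iζ) / (γ - iζ)`. The free resolvent kernel is the Green's kernel
`k_c(x, y) = (c e^{z(x+y)/2} - e^{z|x-y|/2}) / z`.

*The determinant as a Jost function.* The integrand `∏ V(xᵢ) det k_c(xᵢ, xⱼ)` of Fredholm's series is
symmetric and vanishes on the diagonals, so its integral is `n + 1` times the integral over the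
points whose zeroth coordinate `t` is the smallest
(`integral_symmetric_eq_integral_min_first`). On that set the first row is eliminated explicitly: the
determinant is `k_c(t, t)` times the determinant of the Green's kernel with `c` replaced by
`e^{-zt}`, that is, with a Dirichlet condition at `t` (`det_greenKernel_cons`). Iterating, the terms of
Fredholm's series become the Picard iterates of the Volterra equation
`b(x) = 1 + ∫_x^∞ (e^{z(y-x)} - 1) / z · V(y) b(y) dy`
for the Jost solution `e^{iζx} b(x)`, and `D(ζ) = 1 + ∫_0^∞ V(y) k_c(y, y) b(y) dy`
(`exists_perturbationDet_eq`). For large `|ζ|` the Volterra operator has norm at most `1/2`, so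
everything converges geometrically and no Hadamard inequality is needed.

*The expansion.* The `bₙ` are smooth and bounded with derivatives `O((1 + x)^{-ρ})`, and satisfy
`bₙ₊₁' = V bₙ - bₙ''`. Hence `B = ∑_{n ≤ N} bₙ z⁻ⁿ` solves `B'' + z B' = V B` up to the integrable
remainder `-z^{-N} b_{N+1}'` (`jostSumDeriv2_add`). Since `k B' - B` is an antiderivative of
`k (B'' + z B')` for `k(y) = k_c(y, y)` with any `c` (`integral_greenKernel_mul_deriv`), `B` solves
the Volterra equation up to `O(|z|^{-N-1})`, so `b - B = O(|z|^{-N-1})`, and the same integration by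
parts evaluates `D(ζ)` as `B(0) - B'(0) / (γ - iζ) + O(|z|^{-N-1})`
(`HasDecay.exists_norm_perturbationDet_sub_le`). The geometric series of
`1 / (γ - iζ) = -2 / (z - 2γ)` then gives the coefficients `dₙ` (`jostSum_sub_eq`).

*The logarithm.* The recursion for the `ℓₙ` says that `P' = P Q'` up to order `w^N` for the partial
sums `P = ∑ dₙ wⁿ`, `Q = ∑ ℓₙ wⁿ`. So `P e^{-Q} = 1 + O(w^{N+1})` near `w = 0`, and with `w = 1/z` any
logarithm `L → 0` of `D` satisfies `e^{L - Q} = 1 + O(|z|^{-N-1})`, hence `L - Q = O(|z|^{-N-1})`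
(`HasAsymptoticSeries.log`).
-/

noncomputable section

namespace RobinHalfLine

open MeasureTheory BoundedContinuousFunction

/-! ### Symmetric integrals -/

/-- The points of `ℝⁿ` whose `i`-th coordinate is strictly smaller than all the others. -/
def strictMinAt {n : ℕ} (i : Fin n) : Set (Fin n → ℝ) := {x | ∀ j, j ≠ i → x i < x j}

theorem measurableSet_strictMinAt {n : ℕ} (i : Fin n) : MeasurableSet (strictMinAt i) := by
  have : strictMinAt i = ⋂ j, {x : Fin n → ℝ | j ≠ i → x i < x j} := by
    ext x; simp [strictMinAt]
  rw [this]
  refine MeasurableSet.iInter fun j => ?_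
  by_cases h : j = i
  · simp [h]
  · simpa [h] using measurableSet_lt (measurable_pi_apply i) (measurable_pi_apply j)

/-- A point with distinct coordinates lies in exactly one of the sets `strictMinAt i`, so a function
that vanishes at the other points is the sum of its restrictions to these sets. -/
theorem eq_sum_indicator_strictMinAt {n : ℕ} {f : (Fin (n + 1) → ℝ) → ℂ}
    (hf : ∀ x, ¬ Function.Injective x → f x = 0) (x : Fin (n + 1) → ℝ) :
    f x = ∑ i, (strictMinAt i).indicator f x := by
  classical
  by_cases hx : Function.Injective x
  · obtain ⟨i, -, hi⟩ := Finset.exists_min_image Finset.univ x Finset.univ_nonempty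
    have hmem : x ∈ strictMinAt i := fun j hj =>
      lt_of_le_of_ne (hi j (Finset.mem_univ j)) fun h => hj (hx h).symm
    rw [Finset.sum_eq_single i, Set.indicator_of_mem hmem]
    · intro j _ hj
      exact Set.indicator_of_notMem
        (fun h : x ∈ strictMinAt j => lt_asymm (h i hj.symm) (hmem j hj)) f
    · simp
  · simp [hf x hx, Set.indicator_apply]

/-- The integral of a symmetric function that vanishes on the diagonals is `n + 1` times its
integral over the points whose zeroth coordinate is the smallest. -/
theorem integral_symmetric_eq_integral_min_first (μ : Measure ℝ) [SigmaFinite μ] {n : ℕ}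
    {f : (Fin (n + 1) → ℝ) → ℂ} (hfi : Integrable f (Measure.pi fun _ => μ))
    (hsymm : ∀ (σ : Equiv.Perm (Fin (n + 1))) (x), f (fun i => x (σ i)) = f x)
    (hf : ∀ x, ¬ Function.Injective x → f x = 0) :
    ∫ x, f x ∂(Measure.pi fun _ => μ) =
      (n + 1) * ∫ t, ∫ y : Fin n → ℝ, f (Fin.cons t y)
        ∂(Measure.pi fun _ => μ.restrict (Set.Ioi t)) ∂μ := by
  classical
  -- Transposing the coordinates `0` and `i` carries `strictMinAt 0` to `strictMinAt i`.
  have hstep : ∀ i : Fin (n + 1), ∫ x, (strictMinAt i).indicator f x ∂(Measure.pi fun _ => μ) =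
      ∫ x, (strictMinAt 0).indicator f x ∂(Measure.pi fun _ => μ) := by
    intro i
    let σ : Equiv.Perm (Fin (n + 1)) := Equiv.swap 0 i
    have hmp := measurePreserving_piCongrLeft (α := fun _ => ℝ)
      (fun _ : Fin (n + 1) => μ) σ
    rw [← hmp.integral_comp' (g := (strictMinAt i).indicator f)]
    refine integral_congr_ae (ae_of_all _ fun x => ?_)
    have hx : (MeasurableEquiv.piCongrLeft (fun _ => ℝ) σ) x = fun j => x (σ j) := by
      funext j
      have h := Equiv.piCongrLeft_apply_apply (fun _ : Fin (n + 1) => ℝ) σ x (σ j)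
      rw [show σ (σ j) = j from Equiv.swap_swap 0 i |> fun h => Equiv.congr_fun h j] at h
      exact h
    have hiff : (fun j => x (σ j)) ∈ strictMinAt i ↔ x ∈ strictMinAt 0 := by
      have hi : σ i = 0 := Equiv.swap_apply_right 0 i
      have h0 : σ 0 = i := Equiv.swap_apply_left 0 i
      constructor
      · intro h j hj
        have := h (σ j) (fun h' => hj (by rw [← σ.injective (h'.trans h0.symm)]))
        have hσ : σ (σ j) = j := Equiv.congr_fun (Equiv.swap_swap 0 i) j
        simpa [hi, hσ] using this
      · intro h j hj
        have := h (σ j) (fun h' => hj (σ.injective (h'.trans hi.symm)))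
        simpa [hi] using this
    simp only [hx]
    by_cases h : x ∈ strictMinAt 0
    · rw [Set.indicator_of_mem h, Set.indicator_of_mem (hiff.2 h), hsymm]
    · rw [Set.indicator_of_notMem h, Set.indicator_of_notMem (fun h' => h (hiff.1 h'))]
  have hint : ∀ i : Fin (n + 1),
      Integrable ((strictMinAt i).indicator f) (Measure.pi fun _ => μ) := fun i =>
    hfi.indicator (measurableSet_strictMinAt i)
  have hmp := measurePreserving_piFinSuccAbove (α := fun _ => ℝ) (fun _ : Fin (n + 1) => μ) 0
  have hmp' := hmp.symm
  have hcons : ∀ p : ℝ × (Fin n → ℝ),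
      (MeasurableEquiv.piFinSuccAbove (fun _ : Fin (n + 1) => ℝ) 0).symm p
        = Fin.cons p.1 p.2 := by
    intro p
    simp [MeasurableEquiv.piFinSuccAbove, Fin.consEquiv]
  calc ∫ x, f x ∂(Measure.pi fun _ => μ)
      = ∫ x, ∑ i, (strictMinAt i).indicator f x ∂(Measure.pi fun _ => μ) := by
        simp_rw [← eq_sum_indicator_strictMinAt hf]
    _ = (n + 1) * ∫ x, (strictMinAt 0).indicator f x ∂(Measure.pi fun _ => μ) := by
        rw [integral_finsetSum _ fun i _ => hint i, Finset.sum_congr rfl fun i _ => hstep i]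
        simp
    _ = _ := by
        congr 1
        rw [← hmp'.integral_comp' (g := (strictMinAt 0).indicator f), integral_prod]
        · refine integral_congr_ae (ae_of_all _ fun t => ?_)
          simp only [hcons]
          rw [← Measure.restrict_pi_pi, ← integral_indicator
            (MeasurableSet.univ_pi fun _ => measurableSet_Ioi)]
          refine integral_congr_ae (ae_of_all _ fun y => ?_)
          have hiff : (Fin.cons t y : Fin (n + 1) → ℝ) ∈ strictMinAt 0 ↔
              y ∈ Set.univ.pi fun _ : Fin n => Set.Ioi t := by
            simp [strictMinAt, Fin.forall_fin_succ]
          beta_reduce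
          by_cases h : y ∈ Set.univ.pi fun _ : Fin n => Set.Ioi t
          · rw [Set.indicator_of_mem h, Set.indicator_of_mem (hiff.2 h)]
          · rw [Set.indicator_of_notMem h, Set.indicator_of_notMem (fun h' => h (hiff.1 h'))]
        · exact (hmp'.integrable_comp_emb (MeasurableEquiv.measurableEmbedding _)).2 (hint 0)

/-! ### Determinants of Green's kernels -/

/-- The kernel `(c e^{z(x+y)/2} - e^{z|x-y|/2}) / z`. With `z = 2iζ` it is a Green's kernel of
`-d²/dx² - ζ²`; the number `c` encodes the boundary condition. -/
def greenKernel (z c : ℂ) (x y : ℝ) : ℂ :=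
  (c * Complex.exp (z * (x + y) / 2) - Complex.exp (z * |x - y| / 2)) / z

theorem greenKernel_self (z c : ℂ) (x : ℝ) :
    greenKernel z c x x = (c * Complex.exp (z * x) - 1) / z := by
  simp only [greenKernel, sub_self, abs_zero, Complex.ofReal_zero, mul_zero, zero_div,
    Complex.exp_zero]
  congr 4; ring

theorem continuous_greenKernel (z c : ℂ) :
    Continuous fun p : ℝ × ℝ => greenKernel z c p.1 p.2 := by
  unfold greenKernel; fun_prop

/-- Eliminating the row of the smallest point from the determinant of a Green's kernel leaves the
determinant of the Green's kernel with a Dirichlet condition at that point. -/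
theorem det_greenKernel_cons (z c : ℂ) {n : ℕ} (t : ℝ) (y : Fin n → ℝ) (hy : ∀ i, t ≤ y i) :
    (Matrix.of fun i j : Fin (n + 1) => greenKernel z c
      ((Fin.cons t y : Fin (n + 1) → ℝ) i) ((Fin.cons t y : Fin (n + 1) → ℝ) j)).det =
    greenKernel z c t t * (Matrix.of fun i j : Fin n =>
      greenKernel z (Complex.exp (-(z * t))) (y i) (y j)).det := by
  set A : Matrix (Fin (n + 1)) (Fin (n + 1)) ℂ := Matrix.of fun i j => greenKernel z c
      ((Fin.cons t y : Fin (n + 1) → ℝ) i) ((Fin.cons t y : Fin (n + 1) → ℝ) j) with hA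
  -- Column zero of `A` is `A 0 0` times `e^{z(y - t)/2}`, so subtracting these multiples of row zero
  -- clears it below the diagonal.
  let m : Fin (n + 1) → ℂ := Fin.cons 0 fun i => Complex.exp (z * (y i - t) / 2)
  let B : Matrix (Fin (n + 1)) (Fin (n + 1)) ℂ := Matrix.of fun i j => A i j - m i * A 0 j
  have hdet : A.det = B.det := by
    refine Matrix.det_eq_of_forall_row_eq_smul_add_const m 0 rfl fun i j => ?_
    simp [B, m]
  have hcol : ∀ i : Fin n, B i.succ 0 = 0 := by
    intro i
    have h1 : Complex.exp (z * (y i + t) / 2) =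
        Complex.exp (z * (y i - t) / 2) * Complex.exp (z * t) := by
      rw [← Complex.exp_add]; congr 1; ring
    simp only [B, m, hA, Matrix.of_apply, Fin.cons_succ, Fin.cons_zero, greenKernel_self]
    rw [greenKernel, abs_of_nonneg (sub_nonneg.2 (hy i))]
    push_cast
    rw [h1]; ring
  have hsub : ∀ i j : Fin n, B i.succ j.succ =
      greenKernel z (Complex.exp (-(z * t))) (y i) (y j) := by
    intro i j
    have h1 : Complex.exp (-(z * t)) * Complex.exp (z * (y i + y j) / 2) =
        Complex.exp (z * (y i - t) / 2) * Complex.exp (z * (y j - t) / 2) := by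
      rw [← Complex.exp_add, ← Complex.exp_add]; congr 1; ring
    have h2 : Complex.exp (z * (y i + y j) / 2) =
        Complex.exp (z * (y i - t) / 2) * Complex.exp (z * (t + y j) / 2) := by
      rw [← Complex.exp_add]; congr 1; ring
    simp only [B, m, hA, Matrix.of_apply, Fin.cons_succ, Fin.cons_zero]
    simp only [greenKernel]
    rw [h1, abs_sub_comm t, abs_of_nonneg (sub_nonneg.2 (hy j)), h2]
    push_cast
    ring
  rw [hdet, Matrix.det_succ_column_zero, Fin.sum_univ_succ]
  have h0 : B 0 0 = greenKernel z c t t := by simp [B, m, hA]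
  have hminor : B.submatrix (Fin.succAbove 0) Fin.succ = Matrix.of fun i j : Fin n =>
      greenKernel z (Complex.exp (-(z * t))) (y i) (y j) := by
    ext i j; simp [hsub]
  rw [h0, hminor]
  simp [hcol]

theorem norm_exp_mul_le_one {z : ℂ} (hz : z.re ≤ 0) {s : ℝ} (hs : 0 ≤ s) :
    ‖Complex.exp (z * s)‖ ≤ 1 := by
  rw [Complex.norm_exp]
  simpa using mul_nonpos_of_nonpos_of_nonneg hz hs

theorem norm_greenKernel_le {z c : ℂ} {a M : ℝ} (hz : z.re ≤ 0)
    (hc : ‖c * Complex.exp (z * a)‖ ≤ M) {x y : ℝ} (hx : a ≤ x) (hy : a ≤ y) :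
    ‖greenKernel z c x y‖ ≤ (M + 1) / ‖z‖ := by
  have h2 : c * Complex.exp (z * (x + y) / 2) =
      (c * Complex.exp (z * a)) * Complex.exp (z * (((x + y) / 2 - a : ℝ) : ℂ)) := by
    rw [mul_assoc, ← Complex.exp_add]; congr 2; push_cast; ring
  have h3 : z * |x - y| / 2 = z * ((|x - y| / 2 : ℝ) : ℂ) := by push_cast; ring
  rw [greenKernel, norm_div]
  gcongr
  refine (norm_sub_le _ _).trans (add_le_add ?_ ?_)
  · rw [h2, norm_mul]
    exact (mul_le_of_le_one_right (norm_nonneg _) (norm_exp_mul_le_one hz (by linarith))).trans hc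
  · rw [h3]; exact norm_exp_mul_le_one hz (by positivity)

/-! ### Fredholm integrals of Green's kernels -/

/-- The integrand `∏ w(xᵢ) · det k(xᵢ, xⱼ)` of Fredholm's series for the kernel `w(x) k(x, y)`. -/
def fredholmIntegrand (w : ℝ → ℂ) (k : ℝ → ℝ → ℂ) {n : ℕ} (x : Fin n → ℝ) : ℂ :=
  (∏ i, w (x i)) * (Matrix.of fun i j : Fin n => k (x i) (x j)).det

/-- The `n`-th integral in Fredholm's series on `(a, ∞)` for the kernel `w(x) k(x, y)`. -/
def fredholmIntegral (w : ℝ → ℂ) (k : ℝ → ℝ → ℂ) (n : ℕ) (a : ℝ) : ℂ :=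
  ∫ x : Fin n → ℝ, fredholmIntegrand w k x ∂(Measure.pi fun _ => volume.restrict (Set.Ioi a))

theorem fredholmIntegrand_comp_perm (w : ℝ → ℂ) (k : ℝ → ℝ → ℂ) {n : ℕ}
    (σ : Equiv.Perm (Fin n)) (x : Fin n → ℝ) :
    fredholmIntegrand w k (fun i => x (σ i)) = fredholmIntegrand w k x := by
  unfold fredholmIntegrand
  rw [Equiv.prod_comp σ fun i => w (x i)]
  congr 1
  exact Matrix.det_submatrix_equiv_self σ (Matrix.of fun i j => k (x i) (x j))

theorem fredholmIntegrand_eq_zero (w : ℝ → ℂ) (k : ℝ → ℝ → ℂ) {n : ℕ} (x : Fin n → ℝ)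
    (hx : ¬ Function.Injective x) : fredholmIntegrand w k x = 0 := by
  obtain ⟨i, j, hij, hne⟩ : ∃ i j, x i = x j ∧ i ≠ j := by
    simpa [Function.Injective] using hx
  unfold fredholmIntegrand
  rw [Matrix.det_zero_of_row_eq hne, mul_zero]
  funext l
  simp [hij]

theorem integrable_fredholmIntegrand {w : ℝ → ℂ} {k : ℝ → ℝ → ℂ} {a C : ℝ}
    (hw : IntegrableOn w (Set.Ioi a)) (hk : Continuous fun p : ℝ × ℝ => k p.1 p.2)
    (hC : ∀ x y, a ≤ x → a ≤ y → ‖k x y‖ ≤ C) (n : ℕ) :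
    Integrable (fun x : Fin n → ℝ => fredholmIntegrand w k x)
      (Measure.pi fun _ => volume.restrict (Set.Ioi a)) := by
  have hprod : Integrable (fun x : Fin n → ℝ => ∏ i, w (x i))
      (Measure.pi fun _ => volume.restrict (Set.Ioi a)) :=
    Integrable.fintype_prod (f := fun _ => w) fun _ => hw
  have hcont : Continuous fun x : Fin n → ℝ =>
      (Matrix.of fun i j : Fin n => k (x i) (x j)).det := by
    refine Continuous.matrix_det ?_
    refine continuous_matrix fun i j => ?_
    exact hk.comp (f := fun x : Fin n → ℝ => (x i, x j))
      ((continuous_apply i).prodMk (continuous_apply j))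
  refine hprod.mul_bdd (c := (Fintype.card (Fin n)).factorial • C ^ Fintype.card (Fin n))
    hcont.aestronglyMeasurable ?_
  rw [← Measure.restrict_pi_pi]
  refine ae_restrict_of_forall_mem (MeasurableSet.univ_pi fun _ => measurableSet_Ioi) fun x hx => ?_
  exact Matrix.det_le (abv := NormedField.toAbsoluteValue ℂ) fun i j =>
    hC _ _ (le_of_lt (hx i trivial)) (le_of_lt (hx j trivial))

/-- Integrating out the smallest variable: the Fredholm integrals of a Green's kernel on `(a, ∞)`
reduce to those of the Dirichlet kernels on `(t, ∞)`, `t > a`. -/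
theorem fredholmIntegral_greenKernel_succ {w : ℝ → ℂ} {z c : ℂ} {a : ℝ} (hz : z.re ≤ 0)
    (hw : IntegrableOn w (Set.Ioi a)) (n : ℕ) :
    fredholmIntegral w (greenKernel z c) (n + 1) a = (n + 1) * ∫ t in Set.Ioi a,
      w t * greenKernel z c t t *
        fredholmIntegral w (greenKernel z (Complex.exp (-(z * t)))) n t := by
  unfold fredholmIntegral
  rw [integral_symmetric_eq_integral_min_first _
    (integrable_fredholmIntegrand hw (continuous_greenKernel z c)
      (fun x y hx hy => norm_greenKernel_le hz le_rfl hx hy) _)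
    (fredholmIntegrand_comp_perm w _) (fredholmIntegrand_eq_zero w _)]
  congr 1
  refine setIntegral_congr_fun measurableSet_Ioi fun t ht => ?_
  rw [Measure.restrict_restrict measurableSet_Ioi, Set.inter_eq_left.2
    (Set.Ioi_subset_Ioi (le_of_lt ht)), ← integral_const_mul, ← Measure.restrict_pi_pi]
  refine setIntegral_congr_fun (MeasurableSet.univ_pi fun _ => measurableSet_Ioi) fun y hy => ?_
  simp only [fredholmIntegrand]
  rw [det_greenKernel_cons z c t y fun i => le_of_lt (hy i trivial), Fin.prod_univ_succ]
  simp only [Fin.cons_zero, Fin.cons_succ]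
  ring

/-! ### The Volterra equation of the Jost solution -/

/-- The Volterra kernel `(e^{z(y-x)} - 1) / z` for `0 ≤ x ≤ y`, extended continuously by `0` to
`y ≤ x` and constantly to `x ≤ 0`. -/
def volterraKernel (z : ℂ) (x y : ℝ) : ℂ :=
  (Complex.exp (z * (max (y - max x 0) 0 : ℝ)) - 1) / z

theorem continuous_volterraKernel (z : ℂ) :
    Continuous fun p : ℝ × ℝ => volterraKernel z p.1 p.2 := by
  unfold volterraKernel; fun_prop

theorem norm_volterraKernel_le {z : ℂ} (hz : z.re ≤ 0) (x y : ℝ) :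
    ‖volterraKernel z x y‖ ≤ 2 / ‖z‖ := by
  rw [volterraKernel, norm_div]
  gcongr
  refine (norm_sub_le _ _).trans ?_
  have := norm_exp_mul_le_one hz (le_max_right (y - max x 0) 0)
  rw [norm_one]; linarith

theorem volterraKernel_eq_zero (z : ℂ) {x y : ℝ} (h : y ≤ x) : volterraKernel z x y = 0 := by
  have : max (y - max x 0) 0 = 0 := max_eq_right (by linarith [le_max_left x 0])
  simp [volterraKernel, this]

theorem volterraKernel_eq_greenKernel (z : ℂ) {x y : ℝ} (hx : 0 ≤ x) (h : x ≤ y) :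
    volterraKernel z x y = greenKernel z (Complex.exp (-(z * x))) y y := by
  rw [greenKernel_self, volterraKernel, max_eq_left hx, max_eq_left (sub_nonneg.2 h),
    ← Complex.exp_add]
  congr 3; push_cast; ring

theorem integrableOn_mul_mul_boundedContinuous {w : ℝ → ℂ} (hw : IntegrableOn w (Set.Ioi 0))
    {k : ℝ → ℂ} (hk : Continuous k) {C : ℝ} (hC : ∀ y, 0 < y → ‖k y‖ ≤ C) (f : ℝ →ᵇ ℂ) :
    IntegrableOn (fun y => w y * (k y * f y)) (Set.Ioi 0) := by
  refine hw.mul_bdd (c := C * ‖f‖) (hk.mul f.continuous).aestronglyMeasurable ?_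
  refine ae_restrict_of_forall_mem measurableSet_Ioi fun y hy => ?_
  rw [norm_mul]
  exact mul_le_mul (hC y hy) (f.norm_coe_le_norm y) (norm_nonneg _)
    ((norm_nonneg _).trans (hC y hy))

theorem norm_integral_mul_mul_le {w : ℝ → ℂ} (hw : IntegrableOn w (Set.Ioi 0))
    {k : ℝ → ℂ} {C : ℝ} (hC : ∀ y, 0 < y → ‖k y‖ ≤ C) (f : ℝ →ᵇ ℂ) :
    ‖∫ y in Set.Ioi 0, w y * (k y * f y)‖ ≤ C * (∫ y in Set.Ioi 0, ‖w y‖) * ‖f‖ := by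
  calc ‖∫ y in Set.Ioi 0, w y * (k y * f y)‖
      ≤ ∫ y in Set.Ioi 0, ‖w y‖ * (C * ‖f‖) := by
        refine norm_integral_le_of_norm_le (hw.norm.mul_const _) ?_
        refine ae_restrict_of_forall_mem measurableSet_Ioi fun y hy => ?_
        rw [norm_mul, norm_mul]
        have := hC y hy
        gcongr
        · exact (norm_nonneg _).trans this
        · exact f.norm_coe_le_norm y
    _ = C * (∫ y in Set.Ioi 0, ‖w y‖) * ‖f‖ := by
        rw [integral_mul_const]; ring

theorem integral_mul_mul_add {w : ℝ → ℂ} (hw : IntegrableOn w (Set.Ioi 0))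
    {k : ℝ → ℂ} (hk : Continuous k) {C : ℝ} (hC : ∀ y, 0 < y → ‖k y‖ ≤ C) (f g : ℝ →ᵇ ℂ) :
    ∫ y in Set.Ioi 0, w y * (k y * (f + g) y) =
      (∫ y in Set.Ioi 0, w y * (k y * f y)) + ∫ y in Set.Ioi 0, w y * (k y * g y) := by
  rw [← integral_add (integrableOn_mul_mul_boundedContinuous hw hk hC f)
    (integrableOn_mul_mul_boundedContinuous hw hk hC g)]
  refine integral_congr_ae (ae_of_all _ fun y => ?_)
  simp only [BoundedContinuousFunction.coe_add, Pi.add_apply]; ring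

theorem integral_mul_mul_smul (w k : ℝ → ℂ) (r : ℂ) (f : ℝ →ᵇ ℂ) :
    ∫ y in Set.Ioi 0, w y * (k y * (r • f) y) = r * ∫ y in Set.Ioi 0, w y * (k y * f y) := by
  rw [← integral_const_mul]
  refine integral_congr_ae (ae_of_all _ fun y => ?_)
  simp only [BoundedContinuousFunction.coe_smul, smul_eq_mul]; ring

/-- The Volterra operator `(T f)(x) = ∫_x^∞ w(y) (e^{z(y-x)} - 1) / z · f(y) dy`, on bounded
continuous functions on `ℝ`, of which only the restrictions to `[0, ∞)` matter. -/
def volterraOp (z : ℂ) (w : ℝ → ℂ) (hz : z.re ≤ 0) (hw : IntegrableOn w (Set.Ioi 0)) :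
    (ℝ →ᵇ ℂ) →L[ℂ] (ℝ →ᵇ ℂ) :=
  LinearMap.mkContinuous
    { toFun := fun f => BoundedContinuousFunction.ofNormedAddCommGroup
        (fun x => ∫ y in Set.Ioi 0, w y * (volterraKernel z x y * f y))
        (by
          refine continuous_of_dominated (bound := fun y => ‖w y‖ * (2 / ‖z‖ * ‖f‖))
            (fun x => ?_) (fun x => ae_of_all _ fun y => ?_) (hw.norm.mul_const _)
            (ae_of_all _ fun y => ?_)
          · exact (integrableOn_mul_mul_boundedContinuous hw
              ((continuous_volterraKernel z).comp (Continuous.prodMk_right x))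
              (fun y _ => norm_volterraKernel_le hz x y) f).aestronglyMeasurable
          · rw [norm_mul, norm_mul]
            gcongr
            · exact norm_volterraKernel_le hz x y
            · exact f.norm_coe_le_norm y
          · exact continuous_const.mul (((continuous_volterraKernel z).comp
              (Continuous.prodMk_left y)).mul continuous_const))
        (2 / ‖z‖ * (∫ y in Set.Ioi 0, ‖w y‖) * ‖f‖)
        (fun x => norm_integral_mul_mul_le hw (fun y _ => norm_volterraKernel_le hz x y) f)
      map_add' := fun f g => by
        ext x
        exact integral_mul_mul_add hw
          ((continuous_volterraKernel z).comp (Continuous.prodMk_right x))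
          (fun y _ => norm_volterraKernel_le hz x y) f g
      map_smul' := fun r f => by
        ext x
        exact integral_mul_mul_smul w _ r f }
    (2 / ‖z‖ * ∫ y in Set.Ioi 0, ‖w y‖)
    (fun f => BoundedContinuousFunction.norm_ofNormedAddCommGroup_le _
      (by positivity)
      (fun x => norm_integral_mul_mul_le hw (fun y _ => norm_volterraKernel_le hz x y) f))

theorem norm_volterraOp_le {z : ℂ} {w : ℝ → ℂ} (hz : z.re ≤ 0) (hw : IntegrableOn w (Set.Ioi 0)) :
    ‖volterraOp z w hz hw‖ ≤ 2 / ‖z‖ * ∫ y in Set.Ioi 0, ‖w y‖ :=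
  LinearMap.mkContinuous_norm_le _ (by positivity) _

theorem volterraOp_apply {z : ℂ} {w : ℝ → ℂ} (hz : z.re ≤ 0) (hw : IntegrableOn w (Set.Ioi 0))
    (f : ℝ →ᵇ ℂ) {x : ℝ} (hx : 0 ≤ x) :
    volterraOp z w hz hw f x =
      ∫ y in Set.Ioi x, w y * (greenKernel z (Complex.exp (-(z * x))) y y * f y) := by
  change ∫ y in Set.Ioi 0, w y * (volterraKernel z x y * f y) = _
  have hz0 : ∀ y ∈ Set.Ioi 0 \ Set.Ioi x, w y * (volterraKernel z x y * f y) = 0 := by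
    intro y hy
    rw [volterraKernel_eq_zero z (not_lt.1 hy.2)]; ring
  rw [setIntegral_eq_of_subset_of_forall_sdiff_eq_zero measurableSet_Ioi
    (Set.Ioi_subset_Ioi hx) hz0]
  refine setIntegral_congr_fun measurableSet_Ioi fun y hy => ?_
  simp only [volterraKernel_eq_greenKernel z hx (le_of_lt hy)]

theorem norm_greenKernel_self_le {z : ℂ} (c : ℂ) (hz : z.re ≤ 0) {y : ℝ} (hy : 0 < y) :
    ‖greenKernel z c y y‖ ≤ (‖c‖ + 1) / ‖z‖ :=
  norm_greenKernel_le (a := 0) hz (by simp) hy.le hy.le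

theorem continuous_greenKernel_self (z c : ℂ) : Continuous fun y => greenKernel z c y y := by
  unfold greenKernel; fun_prop

theorem volterraOp_apply_max {z : ℂ} {w : ℝ → ℂ} (hz : z.re ≤ 0)
    (hw : IntegrableOn w (Set.Ioi 0)) (f : ℝ →ᵇ ℂ) (x : ℝ) :
    volterraOp z w hz hw f (max x 0) = volterraOp z w hz hw f x := by
  change ∫ y in Set.Ioi 0, w y * (volterraKernel z (max x 0) y * f y) =
    ∫ y in Set.Ioi 0, w y * (volterraKernel z x y * f y)
  simp only [volterraKernel, max_eq_left (le_max_right x 0)]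

/-- The functional `f ↦ ∫_0^∞ w(y) k(y, y) f(y) dy` for the Green's kernel `k`. -/
def greenFunctional (z c : ℂ) (w : ℝ → ℂ) (hz : z.re ≤ 0) (hw : IntegrableOn w (Set.Ioi 0)) :
    (ℝ →ᵇ ℂ) →L[ℂ] ℂ :=
  LinearMap.mkContinuous
    { toFun := fun f => ∫ y in Set.Ioi 0, w y * (greenKernel z c y y * f y)
      map_add' := fun f g => integral_mul_mul_add hw (continuous_greenKernel_self z c)
        (fun _ => norm_greenKernel_self_le c hz) f g
      map_smul' := fun r f => integral_mul_mul_smul w _ r f }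
    ((‖c‖ + 1) / ‖z‖ * ∫ y in Set.Ioi 0, ‖w y‖)
    (fun f => norm_integral_mul_mul_le hw (fun _ => norm_greenKernel_self_le c hz) f)

theorem greenFunctional_apply {z : ℂ} (c : ℂ) {w : ℝ → ℂ} (hz : z.re ≤ 0)
    (hw : IntegrableOn w (Set.Ioi 0)) (f : ℝ →ᵇ ℂ) :
    greenFunctional z c w hz hw f = ∫ y in Set.Ioi 0, w y * (greenKernel z c y y * f y) := rfl

theorem norm_greenFunctional_le {z : ℂ} (c : ℂ) {w : ℝ → ℂ} (hz : z.re ≤ 0)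
    (hw : IntegrableOn w (Set.Ioi 0)) :
    ‖greenFunctional z c w hz hw‖ ≤ (‖c‖ + 1) / ‖z‖ * ∫ y in Set.Ioi 0, ‖w y‖ :=
  LinearMap.mkContinuous_norm_le _ (by positivity) _

/-- The Fredholm integrals of the Dirichlet kernel on `(x, ∞)` are the Picard iterates of the
Volterra equation. -/
theorem fredholmIntegral_dirichlet {z : ℂ} {w : ℝ → ℂ} (hz : z.re ≤ 0)
    (hw : IntegrableOn w (Set.Ioi 0)) (n : ℕ) {x : ℝ} (hx : 0 ≤ x) :
    fredholmIntegral w (greenKernel z (Complex.exp (-(z * x)))) n x =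
      n.factorial * ((volterraOp z w hz hw ^ n) 1) x := by
  induction n generalizing x with
  | zero => simp [fredholmIntegral, fredholmIntegrand, measureReal_def]
  | succ n ih =>
    rw [fredholmIntegral_greenKernel_succ hz (hw.mono_set (Set.Ioi_subset_Ioi hx)),
      pow_succ', mul_apply_eq_comp, volterraOp_apply hz hw _ hx,
      Nat.factorial_succ, Nat.cast_mul, Nat.cast_succ, mul_assoc]
    refine congrArg _ ?_
    rw [← integral_const_mul]
    refine setIntegral_congr_fun measurableSet_Ioi fun t ht => ?_
    have ht : x < t := ht
    rw [ih (hx.trans (le_of_lt ht))]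
    ring

theorem fredholmIntegral_succ_eq_greenFunctional {z : ℂ} (c : ℂ) {w : ℝ → ℂ} (hz : z.re ≤ 0)
    (hw : IntegrableOn w (Set.Ioi 0)) (n : ℕ) :
    fredholmIntegral w (greenKernel z c) (n + 1) 0 =
      (n + 1).factorial * greenFunctional z c w hz hw ((volterraOp z w hz hw ^ n) 1) := by
  rw [fredholmIntegral_greenKernel_succ hz hw, greenFunctional_apply,
      Nat.factorial_succ, Nat.cast_mul, Nat.cast_succ, mul_assoc]
  refine congrArg _ ?_
  rw [← integral_const_mul]
  refine setIntegral_congr_fun measurableSet_Ioi fun t ht => ?_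
  have ht : 0 < t := ht
  rw [fredholmIntegral_dirichlet hz hw n (le_of_lt ht)]
  ring

theorem freeResolventKernel_eq_greenKernel {γ : ℝ} {ζ : ℂ}
    (hγ : (γ : ℂ) - Complex.I * ζ ≠ 0) (x y : ℝ) :
    freeResolventKernel γ ζ x y = greenKernel (2 * Complex.I * ζ)
      (((γ : ℂ) + Complex.I * ζ) / ((γ : ℂ) - Complex.I * ζ)) x y := by
  wlog hxy : x ≤ y generalizing x y
  · have := this y x (le_of_not_ge hxy)
    rw [freeResolventKernel, min_comm, max_comm, ← freeResolventKernel, this]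
    simp only [greenKernel, abs_sub_comm y x, add_comm (y : ℂ)]
  rw [freeResolventKernel, freeRegular, greenKernel, min_eq_left hxy, max_eq_right hxy,
    abs_sub_comm, abs_of_nonneg (sub_nonneg.2 hxy)]
  have h1 : Complex.exp (2 * Complex.I * ζ * (x + y) / 2) =
      Complex.exp (Complex.I * ζ * x) * Complex.exp (Complex.I * ζ * y) := by
    rw [← Complex.exp_add]; congr 1; ring
  have h2 : Complex.exp (2 * Complex.I * ζ * ((y - x : ℝ) : ℂ) / 2) =
      Complex.exp (-(Complex.I * ζ * x)) * Complex.exp (Complex.I * ζ * y) := by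
    rw [← Complex.exp_add]; congr 1; push_cast; ring
  rw [h1, h2]
  generalize (2 * Complex.I * ζ) = z
  field_simp

theorem real_sign_mul_sqrt_abs_mul_sqrt_abs (r : ℝ) :
    Real.sign r * Real.sqrt |r| * Real.sqrt |r| = r := by
  rw [mul_assoc, Real.mul_self_sqrt (abs_nonneg r)]
  rcases lt_trichotomy r 0 with h | h | h
  · rw [Real.sign_of_neg h, abs_of_neg h]; ring
  · simp [h]
  · rw [Real.sign_of_pos h, abs_of_pos h]; ring

theorem det_sandwichKernel {γ : ℝ} (V : ℝ → ℝ) {ζ : ℂ}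
    (hγ : (γ : ℂ) - Complex.I * ζ ≠ 0) {n : ℕ} (x : Fin n → ℝ) :
    (Matrix.of fun i j : Fin n => sandwichKernel γ V ζ (x i) (x j)).det =
      fredholmIntegrand (fun y => (V y : ℂ)) (greenKernel (2 * Complex.I * ζ)
        (((γ : ℂ) + Complex.I * ζ) / ((γ : ℂ) - Complex.I * ζ))) x := by
  set k := greenKernel (2 * Complex.I * ζ)
        (((γ : ℂ) + Complex.I * ζ) / ((γ : ℂ) - Complex.I * ζ)) with hk
  have h : (Matrix.of fun i j : Fin n => sandwichKernel γ V ζ (x i) (x j)) =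
      Matrix.of fun i j : Fin n => ((Real.sign (V (x i)) * Real.sqrt |V (x i)| : ℝ) : ℂ) *
        (Matrix.of fun i j : Fin n => ((Real.sqrt |V (x j)| : ℝ) : ℂ) *
          (Matrix.of fun i j : Fin n => k (x i) (x j)) i j) i j := by
    ext i j
    simp only [Matrix.of_apply, sandwichKernel, freeResolventKernel_eq_greenKernel hγ, ← hk]
    ring
  rw [h, Matrix.det_mul_column, Matrix.det_mul_row, ← mul_assoc, ← Finset.prod_mul_distrib,
    fredholmIntegrand]
  congr 1
  refine Finset.prod_congr rfl fun i _ => ?_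
  rw [← Complex.ofReal_mul, real_sign_mul_sqrt_abs_mul_sqrt_abs]

/-- Fredholm's series for a Green's kernel, summed through the solution `b` of the Volterra equation
`b = 1 + T b`. -/
theorem exists_hasSum_fredholmIntegral {z : ℂ} (c : ℂ) {w : ℝ → ℂ} (hz : z.re ≤ 0)
    (hw : IntegrableOn w (Set.Ioi 0)) (hT : ‖volterraOp z w hz hw‖ < 1) :
    ∃ b : ℝ →ᵇ ℂ, b = 1 + volterraOp z w hz hw b ∧
      HasSum (fun n : ℕ => ((n.factorial : ℕ) : ℂ)⁻¹ * fredholmIntegral w (greenKernel z c) n 0)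
        (1 + greenFunctional z c w hz hw b) := by
  have hsum2 := (greenFunctional z c w hz hw).hasSum ((ContinuousLinearMap.apply ℂ (ℝ →ᵇ ℂ)
    (1 : ℝ →ᵇ ℂ)).hasSum (summable_geometric_of_norm_lt_one hT).hasSum)
  have hS := mul_neg_geom_series (R := (ℝ →ᵇ ℂ) →L[ℂ] (ℝ →ᵇ ℂ)) _ hT
  set T := volterraOp z w hz hw
  refine ⟨(∑' n : ℕ, T ^ n) 1, ?_, ?_⟩
  · have h := congrArg (fun S : (ℝ →ᵇ ℂ) →L[ℂ] (ℝ →ᵇ ℂ) => S 1) hS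
    simp only [mul_apply_eq_comp, _root_.sub_apply, one_apply_eq_self] at h
    exact sub_eq_iff_eq_add.1 h
  · have hterm' : ∀ n : ℕ, (((n + 1).factorial : ℕ) : ℂ)⁻¹ *
        fredholmIntegral w (greenKernel z c) (n + 1) 0 =
        greenFunctional z c w hz hw ((T ^ n) 1) := by
      intro n
      rw [fredholmIntegral_succ_eq_greenFunctional _ hz hw, ← mul_assoc, inv_mul_cancel₀, one_mul]
      exact_mod_cast (n + 1).factorial_ne_zero
    have hzero : fredholmIntegral w (greenKernel z c) 0 0 = 1 := by
      simp [fredholmIntegral, fredholmIntegrand, measureReal_def]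
    refine (hasSum_nat_add_iff' 1).1 ?_
    simp only [hterm', Finset.range_one, Finset.sum_singleton, hzero, Nat.factorial_zero,
      Nat.cast_one, inv_one, mul_one, add_sub_cancel_left]
    exact hsum2

/-- The perturbation determinant in terms of the Jost solution `e^{iζx} b(x)`, where `b` solves the
Volterra equation `b = 1 + T b`. -/
theorem exists_perturbationDet_eq {γ : ℝ} {V : ℝ → ℝ} {ζ : ℂ}
    (hγ : (γ : ℂ) - Complex.I * ζ ≠ 0) (hz : (2 * Complex.I * ζ).re ≤ 0)
    (hV : IntegrableOn (fun y => (V y : ℂ)) (Set.Ioi 0))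
    (hT : ‖volterraOp (2 * Complex.I * ζ) (fun y => (V y : ℂ)) hz hV‖ < 1) :
    ∃ b : ℝ →ᵇ ℂ, b = 1 + volterraOp (2 * Complex.I * ζ) (fun y => (V y : ℂ)) hz hV b ∧
      perturbationDet γ V ζ = 1 + greenFunctional (2 * Complex.I * ζ)
        (((γ : ℂ) + Complex.I * ζ) / ((γ : ℂ) - Complex.I * ζ)) (fun y => (V y : ℂ)) hz hV b := by
  obtain ⟨b, hb, hsum⟩ := exists_hasSum_fredholmIntegral
    (((γ : ℂ) + Complex.I * ζ) / ((γ : ℂ) - Complex.I * ζ)) hz hV hT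
  refine ⟨b, hb, ?_⟩
  rw [← hsum.tsum_eq, perturbationDet, fredholmDet]
  simp only [det_sandwichKernel V hγ, fredholmIntegral, restrict_Ioi_eq_restrict_Ici]

/-! ### Smoothness and decay of the coefficients `bₙ` -/

/-- `f` is smooth on `[0, ∞)` and all its derivatives, including `f` itself, are
`O((1 + x)^{-ρ})`. -/
structure HasDecay (ρ : ℝ) (f : ℝ → ℝ) : Prop where
  contDiffOn : ContDiffOn ℝ ((⊤ : ℕ∞) : WithTop ℕ∞) f (Set.Ici 0)
  bound : ∀ j : ℕ, ∃ C : ℝ, ∀ x : ℝ, 0 ≤ x →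
    |iteratedDerivWithin j f (Set.Ici 0) x| ≤ C * (1 + x) ^ (-ρ)

/-- `f` is smooth and bounded on `[0, ∞)` and all its derivatives of order at least one are
`O((1 + x)^{-ρ})`. -/
structure HasDecayingDeriv (ρ : ℝ) (f : ℝ → ℝ) : Prop where
  contDiffOn : ContDiffOn ℝ ((⊤ : ℕ∞) : WithTop ℕ∞) f (Set.Ici 0)
  bounded : ∃ C : ℝ, ∀ x : ℝ, 0 ≤ x → |f x| ≤ C
  deriv : HasDecay ρ (derivWithin f (Set.Ici 0))

theorem contDiffOn_derivWithin_Ici {f : ℝ → ℝ}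
    (hf : ContDiffOn ℝ ((⊤ : ℕ∞) : WithTop ℕ∞) f (Set.Ici 0)) :
    ContDiffOn ℝ ((⊤ : ℕ∞) : WithTop ℕ∞) (derivWithin f (Set.Ici 0)) (Set.Ici 0) :=
  ((contDiffOn_infty_iff_derivWithin (uniqueDiffOn_Ici 0)).1 hf).2

theorem hasDerivAt_of_contDiffOn_Ici {f : ℝ → ℝ}
    (hf : ContDiffOn ℝ ((⊤ : ℕ∞) : WithTop ℕ∞) f (Set.Ici 0)) {x : ℝ} (hx : 0 < x) :
    HasDerivAt f (derivWithin f (Set.Ici 0) x) x :=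
  (hf.differentiableOn (by simp) x hx.le).hasDerivWithinAt.hasDerivAt (Ici_mem_nhds hx)

variable {ρ : ℝ} {f g : ℝ → ℝ}

theorem HasDecay.deriv (hf : HasDecay ρ f) : HasDecay ρ (derivWithin f (Set.Ici 0)) where
  contDiffOn := contDiffOn_derivWithin_Ici hf.contDiffOn
  bound j := by simpa only [← iteratedDerivWithin_succ'] using hf.bound (j + 1)

theorem HasDecay.congr (hf : HasDecay ρ f) (h : Set.EqOn g f (Set.Ici 0)) : HasDecay ρ g where
  contDiffOn := hf.contDiffOn.congr h
  bound j := by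
    obtain ⟨C, hC⟩ := hf.bound j
    refine ⟨C, fun x hx => ?_⟩
    rw [iteratedDerivWithin_congr h hx]
    exact hC x hx

theorem HasDecay.neg (hf : HasDecay ρ f) : HasDecay ρ (-f) where
  contDiffOn := hf.contDiffOn.neg
  bound j := by
    obtain ⟨C, hC⟩ := hf.bound j
    refine ⟨C, fun x hx => ?_⟩
    rw [iteratedDerivWithin_neg, abs_neg]
    exact hC x hx

theorem HasDecay.sub (hf : HasDecay ρ f) (hg : HasDecay ρ g) : HasDecay ρ (f - g) where
  contDiffOn := hf.contDiffOn.sub hg.contDiffOn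
  bound j := by
    obtain ⟨C, hC⟩ := hf.bound j
    obtain ⟨C', hC'⟩ := hg.bound j
    refine ⟨C + C', fun x hx => ?_⟩
    rw [iteratedDerivWithin_sub (show x ∈ Set.Ici 0 from hx) (uniqueDiffOn_Ici 0)
      ((hf.contDiffOn.of_le (by exact_mod_cast le_top)) x hx)
      ((hg.contDiffOn.of_le (by exact_mod_cast le_top)) x hx), add_mul]
    exact (abs_sub _ _).trans (add_le_add (hC x hx) (hC' x hx))

theorem one_add_rpow_neg_le_one (hρ : 0 ≤ ρ) {x : ℝ} (hx : 0 ≤ x) : (1 + x) ^ (-ρ) ≤ 1 :=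
  Real.rpow_le_one_of_one_le_of_nonpos (by linarith) (by linarith)

theorem HasDecay.exists_bound (hf : HasDecay ρ f) :
    ∃ C : ℝ, ∀ x : ℝ, 0 ≤ x → |f x| ≤ C * (1 + x) ^ (-ρ) := by
  simpa using hf.bound 0

theorem exists_bound_of_le_rpow (hρ : 0 ≤ ρ)
    (hf : ∃ C : ℝ, ∀ x : ℝ, 0 ≤ x → |f x| ≤ C * (1 + x) ^ (-ρ)) :
    ∃ C : ℝ, ∀ x : ℝ, 0 ≤ x → |f x| ≤ C := by
  obtain ⟨C, hC⟩ := hf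
  refine ⟨|C|, fun x hx => (hC x hx).trans ?_⟩
  calc C * (1 + x) ^ (-ρ) ≤ |C| * (1 + x) ^ (-ρ) := by
        gcongr; exact le_abs_self C
    _ ≤ |C| * 1 := by gcongr; exact one_add_rpow_neg_le_one hρ hx
    _ = |C| := mul_one _

theorem HasDecayingDeriv.iteratedDerivWithin_bounded (hρ : 0 ≤ ρ) (hf : HasDecayingDeriv ρ f)
    (j : ℕ) : ∃ C : ℝ, ∀ x : ℝ, 0 ≤ x → |iteratedDerivWithin j f (Set.Ici 0) x| ≤ C := by
  cases j with
  | zero => simpa using hf.bounded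
  | succ j =>
    rw [iteratedDerivWithin_succ']
    exact exists_bound_of_le_rpow hρ (hf.deriv.bound j)

theorem HasDecay.mul (hρ : 0 ≤ ρ) (hf : HasDecay ρ f) (hg : HasDecayingDeriv ρ g) :
    HasDecay ρ (f * g) where
  contDiffOn := hf.contDiffOn.mul hg.contDiffOn
  bound j := by
    choose C hC using hf.bound
    choose C' hC' using hg.iteratedDerivWithin_bounded hρ
    refine ⟨∑ i ∈ Finset.range (j + 1), (j.choose i : ℝ) * C i * C' (j - i), fun x hx => ?_⟩
    rw [iteratedDerivWithin_mul (show x ∈ Set.Ici 0 from hx) (uniqueDiffOn_Ici 0)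
      ((hf.contDiffOn.of_le (by exact_mod_cast le_top)) x hx)
      ((hg.contDiffOn.of_le (by exact_mod_cast le_top)) x hx), Finset.sum_mul]
    refine (Finset.abs_sum_le_sum_abs _ _).trans (Finset.sum_le_sum fun i _ => ?_)
    rw [abs_mul, abs_mul, Nat.abs_cast]
    calc (j.choose i : ℝ) * |iteratedDerivWithin i f (Set.Ici 0) x| *
          |iteratedDerivWithin (j - i) g (Set.Ici 0) x|
        ≤ (j.choose i : ℝ) * (C i * (1 + x) ^ (-ρ)) * C' (j - i) := by
          have h1 := hC i x hx
          gcongr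
          · exact mul_nonneg (Nat.cast_nonneg _) ((abs_nonneg _).trans h1)
          · exact hC' _ x hx
      _ = _ := by ring

theorem HasDecay.integrableOn (hρ : 1 < ρ) (hf : HasDecay ρ f) :
    IntegrableOn f (Set.Ioi 0) := by
  obtain ⟨C, hC⟩ := hf.exists_bound
  have h : IntegrableOn (fun x : ℝ => C * (x + 1) ^ (-ρ)) (Set.Ioi 0) :=
    (integrableOn_add_rpow_Ioi_of_lt (by linarith) (by norm_num)).const_mul C
  refine Integrable.mono' h ((hf.contDiffOn.continuousOn.mono
    Set.Ioi_subset_Ici_self).aestronglyMeasurable measurableSet_Ioi) ?_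
  refine ae_restrict_of_forall_mem measurableSet_Ioi fun x hx => ?_
  rw [Real.norm_eq_abs, add_comm x]
  exact hC x (le_of_lt hx)

theorem HasDecay.tendsto_zero (hρ : 0 < ρ) (hf : HasDecay ρ f) :
    Filter.Tendsto f Filter.atTop (nhds 0) := by
  obtain ⟨C, hC⟩ := hf.exists_bound
  have h : Filter.Tendsto (fun x : ℝ => C * (1 + x) ^ (-ρ)) Filter.atTop (nhds (C * 0)) :=
    ((tendsto_rpow_neg_atTop hρ).comp
      (Filter.tendsto_atTop_add_const_left _ 1 Filter.tendsto_id)).const_mul C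
  rw [mul_zero] at h
  refine squeeze_zero_norm' ?_ h
  filter_upwards [Filter.eventually_ge_atTop 0] with x hx using hC x hx

theorem HasDecay.integral_sub_intervalIntegral (hρ : 1 < ρ) (hf : HasDecay ρ f) {t : ℝ}
    (ht : 0 ≤ t) :
    (∫ y in Set.Ioi 0, f y) - ∫ y in (0 : ℝ)..t, f y = ∫ y in Set.Ioi t, f y := by
  rw [sub_eq_iff_eq_add', intervalIntegral.integral_of_le ht,
    ← setIntegral_union Set.Ioc_disjoint_Ioi_same measurableSet_Ioi
    ((hf.integrableOn hρ).mono_set Set.Ioc_subset_Ioi_self)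
    ((hf.integrableOn hρ).mono_set (Set.Ioi_subset_Ioi ht)), Set.Ioc_union_Ioi_eq_Ioi ht]

/-- The tail integral of a decaying function is differentiable on `[0, ∞)`. -/
theorem HasDecay.hasDerivWithinAt_tail (hρ : 1 < ρ) (hf : HasDecay ρ f) {x : ℝ} (hx : 0 ≤ x) :
    HasDerivWithinAt (fun x => ∫ y in Set.Ioi x, f y) (-f x) (Set.Ici 0) x := by
  -- `f` is replaced by a continuous function on `ℝ` that agrees with it on `[0, ∞)`.
  have hc : Continuous fun y : ℝ => f (max y 0) :=
    hf.contDiffOn.continuousOn.comp_continuous (by fun_prop) fun y => le_max_right y 0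
  have hF : HasDerivAt (fun x => (∫ y in Set.Ioi 0, f y) - ∫ y in (0 : ℝ)..x, f (max y 0))
      (0 - f (max x 0)) x :=
    (hasDerivAt_const x _).sub (hc.integral_hasStrictDerivAt 0 x).hasDerivAt
  rw [max_eq_left hx, zero_sub] at hF
  refine hF.hasDerivWithinAt.congr_of_mem (fun t ht => ?_) hx
  have ht : 0 ≤ t := ht
  have h1 : ∫ y in (0 : ℝ)..t, f (max y 0) = ∫ y in (0 : ℝ)..t, f y := by
    refine intervalIntegral.integral_congr fun y hy => ?_
    rw [Set.uIcc_of_le ht] at hy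
    simp only [max_eq_left hy.1]
  rw [h1, hf.integral_sub_intervalIntegral hρ ht]

theorem HasDecay.tail (hρ : 1 < ρ) (hf : HasDecay ρ f) :
    HasDecayingDeriv ρ (fun x => ∫ y in Set.Ioi x, f y) := by
  have hd : Set.EqOn (derivWithin (fun x => ∫ y in Set.Ioi x, f y) (Set.Ici 0)) (-f)
      (Set.Ici 0) := fun x hx =>
    (hf.hasDerivWithinAt_tail hρ hx).derivWithin (uniqueDiffOn_Ici 0 x hx)
  refine ⟨?_, ⟨∫ y in Set.Ioi 0, |f y|, fun x hx => ?_⟩, hf.neg.congr hd⟩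
  · refine (contDiffOn_infty_iff_derivWithin (uniqueDiffOn_Ici 0)).2 ⟨fun x hx =>
      (hf.hasDerivWithinAt_tail hρ hx).differentiableWithinAt, hf.contDiffOn.neg.congr hd⟩
  · refine (norm_integral_le_integral_norm f).trans ?_
    exact setIntegral_mono_set (hf.integrableOn hρ).norm (ae_of_all _ fun y => norm_nonneg _)
      (Set.Ioi_subset_Ioi hx).eventuallyLE

theorem HasDecay.tendsto_tail (hρ : 1 < ρ) (hf : HasDecay ρ f) :
    Filter.Tendsto (fun x => ∫ y in Set.Ioi x, f y) Filter.atTop (nhds 0) := by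
  have h := intervalIntegral_tendsto_integral_Ioi 0 (hf.integrableOn hρ) Filter.tendsto_id
  have h2 := (tendsto_const_nhds (x := ∫ y in Set.Ioi 0, f y)).sub h
  rw [sub_self] at h2
  refine h2.congr' ?_
  filter_upwards [Filter.eventually_ge_atTop 0] with t ht
  exact hf.integral_sub_intervalIntegral hρ ht

variable {V : ℝ → ℝ}

theorem jostCoeff_succ (V : ℝ → ℝ) (n : ℕ) : jostCoeff V (n + 1) =
    fun x => -derivWithin (jostCoeff V n) (Set.Ici 0) x -
      ∫ y in Set.Ioi x, (V * jostCoeff V n) y := rfl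

/-- The recursion `bₙ₊₁' = V bₙ - bₙ''`. -/
theorem HasDecayingDeriv.derivWithin_jostCoeff_succ (hρ : 1 < ρ) (hV : HasDecay ρ V) {n : ℕ}
    (hn : HasDecayingDeriv ρ (jostCoeff V n)) :
    Set.EqOn (derivWithin (jostCoeff V (n + 1)) (Set.Ici 0))
      (V * jostCoeff V n - derivWithin (derivWithin (jostCoeff V n) (Set.Ici 0)) (Set.Ici 0))
      (Set.Ici 0) := by
  intro x hx
  have h1 := (hn.deriv.contDiffOn.differentiableOn (by simp) x hx).hasDerivWithinAt
  have h2 := (hV.mul (by linarith) hn).hasDerivWithinAt_tail hρ hx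
  rw [jostCoeff_succ, (h1.fun_neg.fun_sub h2).derivWithin (uniqueDiffOn_Ici 0 x hx)]
  simp only [Pi.sub_apply]; ring

theorem derivWithin_jostCoeff_zero (V : ℝ → ℝ) (x : ℝ) :
    derivWithin (jostCoeff V 0) (Set.Ici 0) x = 0 := by
  simp [jostCoeff]

theorem HasDecay.hasDecayingDeriv_jostCoeff (hρ : 1 < ρ) (hV : HasDecay ρ V) (n : ℕ) :
    HasDecayingDeriv ρ (jostCoeff V n) := by
  induction n with
  | zero =>
    refine ⟨contDiffOn_const, ⟨1, fun x _ => by simp [jostCoeff]⟩, ?_⟩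
    rw [show derivWithin (jostCoeff V 0) (Set.Ici 0) = fun _ => 0 from
      funext (derivWithin_jostCoeff_zero V)]
    exact ⟨contDiffOn_const, fun j => ⟨0, fun x _ => by simp⟩⟩
  | succ n ih =>
    have hVb := hV.mul (by linarith) ih
    refine ⟨?_, ?_, (hVb.sub ih.deriv.deriv).congr (ih.derivWithin_jostCoeff_succ hρ hV)⟩
    · exact ih.deriv.contDiffOn.neg.sub (hVb.tail hρ).contDiffOn
    · obtain ⟨C, hC⟩ := exists_bound_of_le_rpow (by linarith) ih.deriv.exists_bound
      obtain ⟨C', hC'⟩ := (hVb.tail hρ).bounded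
      refine ⟨C + C', fun x hx => ?_⟩
      rw [jostCoeff_succ]
      refine (abs_sub _ _).trans (add_le_add ?_ (hC' x hx))
      rw [abs_neg]
      exact hC x hx

theorem HasDecay.tendsto_jostCoeff_succ (hρ : 1 < ρ) (hV : HasDecay ρ V) (n : ℕ) :
    Filter.Tendsto (jostCoeff V (n + 1)) Filter.atTop (nhds 0) := by
  have hn := hV.hasDecayingDeriv_jostCoeff hρ n
  have h := (hn.deriv.tendsto_zero (by linarith)).neg.sub
    ((hV.mul (by linarith) hn).tendsto_tail hρ)
  simpa [jostCoeff_succ] using h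

/-! ### The expansion of the perturbation determinant -/

theorem hasDerivAt_greenKernel_self {z : ℂ} (hz0 : z ≠ 0) (c : ℂ) (y : ℝ) :
    HasDerivAt (fun y : ℝ => greenKernel z c y y) (c * Complex.exp (z * y)) y := by
  simp only [greenKernel_self]
  have h : HasDerivAt (fun w : ℂ => (c * Complex.exp (z * w) - 1) / z)
      (c * Complex.exp (z * (y : ℂ))) (y : ℂ) := by
    have h1 : HasDerivAt (fun w : ℂ => z * w) z (y : ℂ) := by
      simpa using (hasDerivAt_id (y : ℂ)).const_mul z
    refine (((h1.cexp.const_mul c).sub_const 1).div_const z).congr_deriv ?_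
    field_simp
  exact h.comp_ofReal

/-- Integration by parts: for `k(y) = (c e^{zy} - 1) / z` the function `k B' - B` is an
antiderivative of `k (B'' + z B')`. -/
theorem integral_greenKernel_mul_deriv {z c : ℂ} {a : ℝ} {B B' B'' : ℝ → ℂ} (hz0 : z ≠ 0)
    (hz : z.re ≤ 0) (hB : ContinuousWithinAt B (Set.Ici a) a)
    (hB' : ContinuousWithinAt B' (Set.Ici a) a)
    (hd : ∀ y ∈ Set.Ioi a, HasDerivAt B (B' y) y) (hd' : ∀ y ∈ Set.Ioi a, HasDerivAt B' (B'' y) y)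
    (hi : IntegrableOn B' (Set.Ioi a)) (hi' : IntegrableOn B'' (Set.Ioi a))
    (hlim : Filter.Tendsto B Filter.atTop (nhds 1))
    (hlim' : Filter.Tendsto B' Filter.atTop (nhds 0)) :
    IntegrableOn (fun y => greenKernel z c y y * (B'' y + z * B' y)) (Set.Ioi a) ∧
    ∫ y in Set.Ioi a, greenKernel z c y y * (B'' y + z * B' y) =
      B a - 1 - greenKernel z c a a * B' a := by
  have hbd : ∀ y, a ≤ y →
      ‖greenKernel z c y y‖ ≤ (‖c * Complex.exp (z * a)‖ + 1) / ‖z‖ := fun y hy =>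
    norm_greenKernel_le hz le_rfl hy hy
  have hint : IntegrableOn (fun y => greenKernel z c y y * (B'' y + z * B' y)) (Set.Ioi a) := by
    refine Integrable.bdd_mul (hi'.add (hi.const_mul z))
      (continuous_greenKernel_self z c).aestronglyMeasurable
      (ae_restrict_of_forall_mem measurableSet_Ioi fun y hy => hbd y (le_of_lt hy))
  have hlim0 : Filter.Tendsto (fun y => greenKernel z c y y * B' y) Filter.atTop (nhds 0) := by
    have h := hlim'.norm.const_mul ((‖c * Complex.exp (z * a)‖ + 1) / ‖z‖)
    rw [norm_zero, mul_zero] at h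
    refine squeeze_zero_norm' ?_ h
    filter_upwards [Filter.eventually_ge_atTop a] with y hy
    rw [norm_mul]
    gcongr
    exact hbd y hy
  have hF := integral_Ioi_of_hasDerivAt_of_tendsto
    (f := fun y => greenKernel z c y y * B' y - B y) (m := 0 - 1)
    (f' := fun y => greenKernel z c y y * (B'' y + z * B' y))
    (((continuous_greenKernel_self z c).continuousWithinAt.mul hB').sub hB)
    (fun y hy => by
      refine (((hasDerivAt_greenKernel_self hz0 c y).mul (hd' y hy)).sub (hd y hy)).congr_deriv ?_
      rw [greenKernel_self]
      field_simp
      ring)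
    hint (hlim0.sub hlim)
  exact ⟨hint, hF.trans (by ring)⟩

/-- The partial sum `∑_{n ≤ N} bₙ z⁻ⁿ` of the formal Jost solution. -/
def jostSum (V : ℝ → ℝ) (N : ℕ) (z : ℂ) (y : ℝ) : ℂ :=
  ∑ n ∈ Finset.range (N + 1), (jostCoeff V n y : ℂ) * (z ^ n)⁻¹

/-- The derivative of `jostSum`. -/
def jostSumDeriv (V : ℝ → ℝ) (N : ℕ) (z : ℂ) (y : ℝ) : ℂ :=
  ∑ n ∈ Finset.range (N + 1), ((derivWithin (jostCoeff V n) (Set.Ici 0) y : ℝ) : ℂ) * (z ^ n)⁻¹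

/-- The second derivative of `jostSum`. -/
def jostSumDeriv2 (V : ℝ → ℝ) (N : ℕ) (z : ℂ) (y : ℝ) : ℂ :=
  ∑ n ∈ Finset.range (N + 1),
    ((derivWithin (derivWithin (jostCoeff V n) (Set.Ici 0)) (Set.Ici 0) y : ℝ) : ℂ) * (z ^ n)⁻¹

variable {ρ : ℝ} {V : ℝ → ℝ}

theorem continuousOn_sum_ofReal_mul {f : ℕ → ℝ → ℝ} {s : Set ℝ} (hf : ∀ n, ContinuousOn (f n) s)
    (N : ℕ) (a : ℕ → ℂ) :
    ContinuousOn (fun y => ∑ n ∈ Finset.range N, (f n y : ℂ) * a n) s :=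
  continuousOn_finsetSum _ fun n _ =>
    (Complex.continuous_ofReal.comp_continuousOn (hf n)).mul continuousOn_const

theorem hasDerivAt_sum_ofReal_mul {f f' : ℕ → ℝ → ℝ} {y : ℝ}
    (hf : ∀ n, HasDerivAt (f n) (f' n y) y) (N : ℕ) (a : ℕ → ℂ) :
    HasDerivAt (fun y => ∑ n ∈ Finset.range N, (f n y : ℂ) * a n)
      (∑ n ∈ Finset.range N, (f' n y : ℂ) * a n) y :=
  HasDerivAt.fun_sum fun n _ => (hf n).ofReal_comp.mul_const _

theorem integrableOn_sum_ofReal_mul {f : ℕ → ℝ → ℝ} {s : Set ℝ}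
    (hf : ∀ n, IntegrableOn (f n) s) (N : ℕ) (a : ℕ → ℂ) :
    IntegrableOn (fun y => ∑ n ∈ Finset.range N, (f n y : ℂ) * a n) s :=
  integrable_finsetSum _ fun n _ => (hf n).ofReal.mul_const _

/-- `jostSum` solves the equation `B'' + z B' = V B` up to one term, as the recursion for the `bₙ`
telescopes. -/
theorem jostSumDeriv2_add (hρ : 1 < ρ) (hV : HasDecay ρ V) (N : ℕ) {z : ℂ} (hz0 : z ≠ 0) {y : ℝ}
    (hy : 0 ≤ y) :
    jostSumDeriv2 V N z y + z * jostSumDeriv V N z y = V y * jostSum V N z y -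
      (z ^ N)⁻¹ * ((derivWithin (jostCoeff V (N + 1)) (Set.Ici 0) y : ℝ) : ℂ) := by
  have hrec : ∀ n, ((derivWithin (jostCoeff V (n + 1)) (Set.Ici 0) y : ℝ) : ℂ) =
      V y * jostCoeff V n y -
        ((derivWithin (derivWithin (jostCoeff V n) (Set.Ici 0)) (Set.Ici 0) y : ℝ) : ℂ) := by
    intro n
    rw [(hV.hasDecayingDeriv_jostCoeff hρ n).derivWithin_jostCoeff_succ hρ hV hy]
    simp
  induction N with
  | zero =>
    simp [jostSum, jostSumDeriv, jostSumDeriv2, hrec 0, derivWithin_jostCoeff_zero]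
  | succ N ih =>
    simp only [jostSum, jostSumDeriv, jostSumDeriv2] at ih ⊢
    rw [Finset.sum_range_succ _ (N + 1), Finset.sum_range_succ _ (N + 1),
      Finset.sum_range_succ _ (N + 1), hrec (N + 1), mul_add z, mul_add (V y : ℂ)]
    have hpow : z * (((derivWithin (jostCoeff V (N + 1)) (Set.Ici 0) y : ℝ) : ℂ) * (z ^ (N + 1))⁻¹) =
        (z ^ N)⁻¹ * ((derivWithin (jostCoeff V (N + 1)) (Set.Ici 0) y : ℝ) : ℂ) := by
      rw [pow_succ]; field_simp
    linear_combination ih + hpow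

theorem HasDecay.tendsto_jostSum (hρ : 1 < ρ) (hV : HasDecay ρ V) (N : ℕ) (z : ℂ) :
    Filter.Tendsto (jostSum V N z) Filter.atTop (nhds 1) := by
  have h : Filter.Tendsto (fun y => (∑ n ∈ Finset.range N,
      (jostCoeff V (n + 1) y : ℂ) * (z ^ (n + 1))⁻¹) + 1) Filter.atTop
      (nhds ((∑ n ∈ Finset.range N, ((0 : ℝ) : ℂ) * (z ^ (n + 1))⁻¹) + 1)) :=
    (tendsto_finsetSum _ fun n _ => ((Complex.continuous_ofReal.tendsto 0).comp
      (hV.tendsto_jostCoeff_succ hρ n)).mul_const _).add_const 1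
  simp only [Complex.ofReal_zero, zero_mul, Finset.sum_const_zero, zero_add] at h
  refine h.congr fun y => ?_
  rw [jostSum, Finset.sum_range_succ']
  simp [jostCoeff]

theorem HasDecay.tendsto_jostSumDeriv (hρ : 1 < ρ) (hV : HasDecay ρ V) (N : ℕ) (z : ℂ) :
    Filter.Tendsto (jostSumDeriv V N z) Filter.atTop (nhds 0) := by
  have h : Filter.Tendsto (jostSumDeriv V N z) Filter.atTop
      (nhds (∑ n ∈ Finset.range (N + 1), ((0 : ℝ) : ℂ) * (z ^ n)⁻¹)) :=
    tendsto_finsetSum _ fun n _ => ((Complex.continuous_ofReal.tendsto 0).comp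
      ((hV.hasDecayingDeriv_jostCoeff hρ n).deriv.tendsto_zero (by linarith))).mul_const _
  simpa using h

theorem HasDecay.continuousOn_jostSum (hρ : 1 < ρ) (hV : HasDecay ρ V) (N : ℕ) (z : ℂ) :
    ContinuousOn (jostSum V N z) (Set.Ici 0) :=
  continuousOn_sum_ofReal_mul
    (fun n => (hV.hasDecayingDeriv_jostCoeff hρ n).contDiffOn.continuousOn) _ _

/-- Integrals of `V B` for `B = jostSum` against a Green's kernel, up to the remainder. -/
theorem HasDecay.integral_mul_jostSum (hρ : 1 < ρ) (hV : HasDecay ρ V) (N : ℕ) {z : ℂ} (c : ℂ)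
    (hz0 : z ≠ 0) (hz : z.re ≤ 0) {a : ℝ} (ha : 0 ≤ a) :
    ∫ y in Set.Ioi a, (V y : ℂ) * (greenKernel z c y y * jostSum V N z y) =
      jostSum V N z a - 1 - greenKernel z c a a * jostSumDeriv V N z a +
        (z ^ N)⁻¹ * ∫ y in Set.Ioi a,
          greenKernel z c y y * ((derivWithin (jostCoeff V (N + 1)) (Set.Ici 0) y : ℝ) : ℂ) := by
  have hb := hV.hasDecayingDeriv_jostCoeff hρ
  have hsub : Set.Ioi a ⊆ Set.Ioi 0 := Set.Ioi_subset_Ioi ha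
  have hcont : ∀ f : ℝ → ℂ, ContinuousOn f (Set.Ici 0) → ContinuousWithinAt f (Set.Ici a) a :=
    fun f hf => (hf a ha).mono (Set.Ici_subset_Ici.2 ha)
  obtain ⟨hint, hparts⟩ := integral_greenKernel_mul_deriv (c := c) (a := a) hz0 hz
    (B := jostSum V N z) (B' := jostSumDeriv V N z) (B'' := jostSumDeriv2 V N z)
    (hcont _ (hV.continuousOn_jostSum hρ N z))
    (hcont _ (continuousOn_sum_ofReal_mul (fun n => (hb n).deriv.contDiffOn.continuousOn) _ _))
    (fun y hy => hasDerivAt_sum_ofReal_mul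
      (fun n => hasDerivAt_of_contDiffOn_Ici (hb n).contDiffOn (hsub hy)) _ _)
    (fun y hy => hasDerivAt_sum_ofReal_mul
      (fun n => hasDerivAt_of_contDiffOn_Ici (hb n).deriv.contDiffOn (hsub hy)) _ _)
    (integrableOn_sum_ofReal_mul (fun n => ((hb n).deriv.integrableOn hρ).mono_set hsub) _ _)
    (integrableOn_sum_ofReal_mul (fun n => ((hb n).deriv.deriv.integrableOn hρ).mono_set hsub) _ _)
    (hV.tendsto_jostSum hρ N z) (hV.tendsto_jostSumDeriv hρ N z)
  have hrem : IntegrableOn (fun y => greenKernel z c y y *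
      ((derivWithin (jostCoeff V (N + 1)) (Set.Ici 0) y : ℝ) : ℂ)) (Set.Ioi a) :=
    Integrable.bdd_mul (((hb (N + 1)).deriv.integrableOn hρ).mono_set hsub).ofReal
      (continuous_greenKernel_self z c).aestronglyMeasurable
      (ae_restrict_of_forall_mem measurableSet_Ioi fun y hy =>
        norm_greenKernel_self_le c hz (hsub hy))
  rw [← hparts, ← integral_const_mul, ← integral_add hint (hrem.const_mul _)]
  refine setIntegral_congr_fun measurableSet_Ioi fun y hy => ?_
  rw [jostSumDeriv2_add hρ hV N hz0 (le_of_lt (hsub hy))]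
  ring

theorem norm_integral_greenKernel_mul_le {z c : ℂ} {a M : ℝ} (hz : z.re ≤ 0)
    (ha : 0 ≤ a) (hc : ‖c * Complex.exp (z * a)‖ ≤ M) {f : ℝ → ℝ} (hf : IntegrableOn f (Set.Ioi 0)) :
    ‖∫ y in Set.Ioi a, greenKernel z c y y * (f y : ℂ)‖ ≤
      (M + 1) / ‖z‖ * ∫ y in Set.Ioi 0, |f y| := by
  have hM : 0 ≤ M := (norm_nonneg _).trans hc
  calc ‖∫ y in Set.Ioi a, greenKernel z c y y * (f y : ℂ)‖
      ≤ ∫ y in Set.Ioi a, (M + 1) / ‖z‖ * |f y| := by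
        refine norm_integral_le_of_norm_le
          ((hf.mono_set (Set.Ioi_subset_Ioi ha)).abs.const_mul _) ?_
        refine ae_restrict_of_forall_mem measurableSet_Ioi fun y hy => ?_
        rw [norm_mul, Complex.norm_real, Real.norm_eq_abs]
        gcongr
        exact norm_greenKernel_le hz hc (le_of_lt hy) (le_of_lt hy)
    _ ≤ _ := by
        rw [integral_const_mul]
        refine mul_le_mul_of_nonneg_left ?_ (by positivity)
        exact setIntegral_mono_set hf.abs (ae_of_all _ fun y => abs_nonneg _)
          (Set.Ioi_subset_Ioi ha).eventuallyLE

/-- `jostSum` as a bounded continuous function on `ℝ`, constant on `(-∞, 0]`. -/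
theorem HasDecay.exists_boundedContinuous_jostSum (hρ : 1 < ρ) (hV : HasDecay ρ V) (N : ℕ)
    (z : ℂ) : ∃ B : ℝ →ᵇ ℂ, ∀ x, B x = jostSum V N z (max x 0) := by
  choose C hC using fun n => (hV.hasDecayingDeriv_jostCoeff hρ n).bounded
  refine ⟨BoundedContinuousFunction.ofNormedAddCommGroup (fun x => jostSum V N z (max x 0))
    ((hV.continuousOn_jostSum hρ N z).comp_continuous (by fun_prop) fun x => le_max_right x 0)
    (∑ n ∈ Finset.range (N + 1), C n * ‖(z ^ n)⁻¹‖) fun x => ?_, fun x => rfl⟩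
  refine norm_sum_le_of_le _ fun n _ => ?_
  rw [norm_mul, Complex.norm_real]
  gcongr
  exact hC n _ (le_max_right x 0)

theorem half_norm_le_norm_sub {γ : ℝ} {ζ : ℂ} (h : 2 * |γ| ≤ ‖ζ‖) :
    ‖ζ‖ / 2 ≤ ‖(γ : ℂ) - Complex.I * ζ‖ := by
  have := norm_sub_norm_le (Complex.I * ζ) (γ : ℂ)
  rw [norm_sub_rev, norm_mul, Complex.norm_I, one_mul, Complex.norm_real, Real.norm_eq_abs] at this
  linarith

/-- The perturbation determinant differs from the formal Jost function
`B_N(0) - B_N'(0) / (γ - iζ)` by `O(|ζ|^{-N-1})`. -/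
theorem HasDecay.exists_norm_perturbationDet_sub_le (γ : ℝ) (hρ : 1 < ρ) (hV : HasDecay ρ V)
    (N : ℕ) : ∃ R C : ℝ, ∀ ζ : ℂ, 0 ≤ ζ.im → R ≤ ‖ζ‖ →
      ‖perturbationDet γ V ζ - (jostSum V N (2 * Complex.I * ζ) 0 -
        jostSumDeriv V N (2 * Complex.I * ζ) 0 / ((γ : ℂ) - Complex.I * ζ))‖ ≤
        C * (‖ζ‖ ^ (N + 1))⁻¹ := by
  have hw : IntegrableOn (fun y => (V y : ℂ)) (Set.Ioi 0) := (hV.integrableOn hρ).ofReal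
  set A : ℝ := ∫ y in Set.Ioi 0, ‖(V y : ℂ)‖ with hA
  have hA0 : 0 ≤ A := by positivity
  have hf : IntegrableOn (derivWithin (jostCoeff V (N + 1)) (Set.Ici 0)) (Set.Ioi 0) :=
    (hV.hasDecayingDeriv_jostCoeff hρ (N + 1)).deriv.integrableOn hρ
  set E : ℝ := ∫ y in Set.Ioi 0, |derivWithin (jostCoeff V (N + 1)) (Set.Ici 0) y| with hE
  have hE0 : 0 ≤ E := by positivity
  -- `2 * A ≤ ‖ζ‖` makes the Volterra operator a contraction, `2 * |γ| ≤ ‖ζ‖` keeps `γ - iζ` away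
  -- from `0` and `‖c‖` below `3`.
  refine ⟨max 1 (2 * A + 2 * |γ|), 2 * E + 2 * E, fun ζ him hR => ?_⟩
  have hR1 : 1 ≤ ‖ζ‖ := (le_max_left _ _).trans hR
  have hR2 : 2 * A + 2 * |γ| ≤ ‖ζ‖ := (le_max_right _ _).trans hR
  have hζpos : 0 < ‖ζ‖ := by linarith
  have hζ0 : ζ ≠ 0 := norm_pos_iff.1 hζpos
  have hγabs := abs_nonneg γ
  have hγn : ‖ζ‖ / 2 ≤ ‖(γ : ℂ) - Complex.I * ζ‖ := half_norm_le_norm_sub (by linarith)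
  have hγ : (γ : ℂ) - Complex.I * ζ ≠ 0 := norm_pos_iff.1 (by linarith)
  set z : ℂ := 2 * Complex.I * ζ with hzdef
  set c : ℂ := ((γ : ℂ) + Complex.I * ζ) / ((γ : ℂ) - Complex.I * ζ) with hcdef
  have hzn : ‖z‖ = 2 * ‖ζ‖ := by simp [hzdef]
  have hz0 : z ≠ 0 := by simp [hzdef, hζ0]
  have hz : z.re ≤ 0 := by simp [hzdef]; exact him
  have hc : ‖c‖ ≤ 3 := by
    rw [hcdef, norm_div, div_le_iff₀ (by linarith)]
    have := norm_add_le (γ : ℂ) (Complex.I * ζ)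
    rw [norm_mul, Complex.norm_I, one_mul, Complex.norm_real, Real.norm_eq_abs] at this
    linarith
  have hT : ‖volterraOp z (fun y => (V y : ℂ)) hz hw‖ ≤ 1 / 2 := by
    refine (norm_volterraOp_le hz hw).trans ?_
    rw [hzn, ← hA, div_mul_eq_mul_div, div_le_div_iff₀ (by positivity) (by positivity)]
    linarith
  have hΛ : ‖greenFunctional z c (fun y => (V y : ℂ)) hz hw‖ ≤ 1 := by
    refine (norm_greenFunctional_le c hz hw).trans ?_
    rw [hzn, ← hA, div_mul_eq_mul_div, div_le_one (by positivity)]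
    nlinarith
  obtain ⟨b, hb, hD⟩ := exists_perturbationDet_eq hγ hz hw (hT.trans_lt (by norm_num))
  obtain ⟨B, hB⟩ := hV.exists_boundedContinuous_jostSum hρ N z
  rw [← hcdef] at hD
  set T := volterraOp z (fun y => (V y : ℂ)) hz hw with hTdef
  set Λ := greenFunctional z c (fun y => (V y : ℂ)) hz hw with hΛdef
  have hB0 : ∀ y : ℝ, 0 ≤ y → B y = jostSum V N z y := fun y hy => by rw [hB, max_eq_left hy]
  have hpow : ‖(z ^ N)⁻¹‖ * (1 / ‖ζ‖) ≤ (‖ζ‖ ^ (N + 1))⁻¹ := by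
    rw [norm_inv, norm_pow, pow_succ, mul_inv, one_div]
    gcongr
    rw [hzn]; linarith
  -- The residual of `B` in the Volterra equation.
  have hres : ‖B - T B - 1‖ ≤ E * (‖ζ‖ ^ (N + 1))⁻¹ := by
    refine (BoundedContinuousFunction.norm_le (by positivity)).2 fun x => ?_
    have hx : 0 ≤ max x 0 := le_max_right x 0
    have hTx : T B x = jostSum V N z (max x 0) - 1 + (z ^ N)⁻¹ * ∫ y in Set.Ioi (max x 0),
        greenKernel z (Complex.exp (-(z * (max x 0 : ℝ)))) y y *
          ((derivWithin (jostCoeff V (N + 1)) (Set.Ici 0) y : ℝ) : ℂ) := by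
      rw [hTdef, ← volterraOp_apply_max, volterraOp_apply hz hw B hx]
      have h := hV.integral_mul_jostSum hρ N (Complex.exp (-(z * (max x 0 : ℝ)))) hz0 hz hx
      have hk : greenKernel z (Complex.exp (-(z * (max x 0 : ℝ)))) (max x 0) (max x 0) = 0 := by
        rw [greenKernel_self, ← Complex.exp_add]; simp
      rw [hk, zero_mul, sub_zero] at h
      rw [← h]
      refine setIntegral_congr_fun measurableSet_Ioi fun y hy => ?_
      rw [hB0 y (hx.trans (le_of_lt hy))]
    have hbound := norm_integral_greenKernel_mul_le (c := Complex.exp (-(z * (max x 0 : ℝ))))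
      (M := 1) hz hx (by rw [← Complex.exp_add]; simp) hf
    have hval : (B - T B - 1) x = -((z ^ N)⁻¹ * ∫ y in Set.Ioi (max x 0),
        greenKernel z (Complex.exp (-(z * (max x 0 : ℝ)))) y y *
          ((derivWithin (jostCoeff V (N + 1)) (Set.Ici 0) y : ℝ) : ℂ)) := by
      simp only [BoundedContinuousFunction.coe_sub, Pi.sub_apply, BoundedContinuousFunction.coe_one,
        Pi.one_apply, hTx, hB]
      ring
    rw [hval, norm_neg, norm_mul]
    calc _ ≤ ‖(z ^ N)⁻¹‖ * ((1 + 1) / ‖z‖ * E) := by gcongr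
      _ = E * (‖(z ^ N)⁻¹‖ * (1 / ‖ζ‖)) := by rw [hzn]; field_simp; ring
      _ ≤ _ := by gcongr
  -- `b` and `B` solve the Volterra equation with nearby right-hand sides, and `‖T‖ ≤ 1 / 2`.
  have hdiff : ‖b - B‖ ≤ 2 * (E * (‖ζ‖ ^ (N + 1))⁻¹) := by
    have h1 : b - B = T (b - B) - (B - T B - 1) := by
      rw [map_sub]
      nth_rw 1 [hb]
      abel
    have h2 : ‖b - B‖ ≤ 1 / 2 * ‖b - B‖ + ‖B - T B - 1‖ := by
      nth_rw 1 [h1]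
      refine (norm_sub_le _ _).trans ?_
      gcongr
      exact T.le_of_opNorm_le hT _
    linarith
  have hΛB : Λ B = jostSum V N z 0 - 1 - jostSumDeriv V N z 0 / ((γ : ℂ) - Complex.I * ζ) +
      (z ^ N)⁻¹ * ∫ y in Set.Ioi 0,
        greenKernel z c y y * ((derivWithin (jostCoeff V (N + 1)) (Set.Ici 0) y : ℝ) : ℂ) := by
    have h := hV.integral_mul_jostSum hρ N c hz0 hz le_rfl
    have hk : greenKernel z c 0 0 = 1 / ((γ : ℂ) - Complex.I * ζ) := by
      rw [greenKernel_self, hcdef, hzdef]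
      simp only [Complex.ofReal_zero, mul_zero, Complex.exp_zero, mul_one]
      field_simp
      ring
    rw [hk, one_div_mul_eq_div] at h
    rw [← h, hΛdef, greenFunctional_apply]
    refine setIntegral_congr_fun measurableSet_Ioi fun y hy => ?_
    rw [hB0 y (le_of_lt hy)]
  have hbound := norm_integral_greenKernel_mul_le (c := c) (M := 3) (a := 0) hz le_rfl
    (by simpa using hc) hf
  have hfinal : perturbationDet γ V ζ - (jostSum V N z 0 -
      jostSumDeriv V N z 0 / ((γ : ℂ) - Complex.I * ζ)) =
      Λ (b - B) + (z ^ N)⁻¹ * ∫ y in Set.Ioi 0,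
        greenKernel z c y y * ((derivWithin (jostCoeff V (N + 1)) (Set.Ici 0) y : ℝ) : ℂ) := by
    rw [hD, map_sub, hΛB]; ring
  rw [hfinal]
  calc _ ≤ ‖Λ (b - B)‖ + ‖(z ^ N)⁻¹ * ∫ y in Set.Ioi 0,
        greenKernel z c y y * ((derivWithin (jostCoeff V (N + 1)) (Set.Ici 0) y : ℝ) : ℂ)‖ :=
        norm_add_le _ _
    _ ≤ 1 * (2 * (E * (‖ζ‖ ^ (N + 1))⁻¹)) + ‖(z ^ N)⁻¹‖ * ((3 + 1) / ‖z‖ * E) := by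
        rw [norm_mul]
        gcongr
        exact (Λ.le_of_opNorm_le hΛ _).trans (by gcongr)
    _ = 2 * E * (‖ζ‖ ^ (N + 1))⁻¹ + 2 * E * (‖(z ^ N)⁻¹‖ * (1 / ‖ζ‖)) := by
        rw [hzn]; field_simp; ring
    _ ≤ 2 * E * (‖ζ‖ ^ (N + 1))⁻¹ + 2 * E * (‖ζ‖ ^ (N + 1))⁻¹ := by gcongr
    _ = _ := by ring

/-! ### The coefficients of the determinant -/

theorem eventually_upperInfinity (R : ℝ) : ∀ᶠ ζ in upperInfinity, R ≤ ‖ζ‖ ∧ 0 ≤ ζ.im := by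
  refine Filter.Eventually.and ?_ ?_
  · exact (tendsto_norm_cobounded_atTop.eventually_ge_atTop R).filter_mono inf_le_left
  · exact Filter.mem_inf_of_right (Filter.mem_principal_self _)

theorem detCoeff_eq (γ : ℝ) (V : ℝ → ℝ) (n : ℕ) : detCoeff γ V n =
    jostCoeff V n 0 + 2 * ∑ m ∈ Finset.Ico 1 n,
      derivWithin (jostCoeff V m) (Set.Ici 0) 0 * (2 * γ) ^ (n - m - 1) := by
  rcases eq_or_ne n 0 with rfl | hn
  · simp [detCoeff, jostCoeff]
  · rw [detCoeff, if_neg hn]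

theorem detCoeff_zero (γ : ℝ) (V : ℝ → ℝ) : detCoeff γ V 0 = 1 := by simp [detCoeff]

/-- The expansion of `z⁻ᵐ / (z - a)` in powers of `z⁻¹`, with exact remainder. -/
theorem inv_pow_mul_inv_sub_eq {z a : ℂ} (hz : z ≠ 0) (ha : z - a ≠ 0) {m N : ℕ} (h : m ≤ N) :
    (z ^ m)⁻¹ * (z - a)⁻¹ = (∑ n ∈ Finset.Ico (m + 1) (N + 1), a ^ (n - m - 1) * (z ^ n)⁻¹) +
      a ^ (N - m) * (z ^ N)⁻¹ * (z - a)⁻¹ := by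
  induction N, h using Nat.le_induction with
  | base => simp
  | succ N hmN ih =>
    rw [ih, Finset.sum_Ico_succ_top (a := m + 1) (b := N + 1) (by omega), add_assoc]
    congr 1
    rw [show N + 1 - m - 1 = N - m by omega, show N + 1 - m = (N - m) + 1 by omega, pow_succ z,
      pow_succ a]
    field_simp
    ring

/-- The formal Jost function `B_N(0) - B_N'(0) / (γ - iζ)` agrees with the partial sum of the series
with coefficients `dₙ` up to the remainders of the geometric series for `1 / (γ - iζ)`. -/
theorem jostSum_sub_eq (γ : ℝ) (V : ℝ → ℝ) (N : ℕ) {ζ : ℂ} (hζ : ζ ≠ 0)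
    (hγ : (γ : ℂ) - Complex.I * ζ ≠ 0) :
    jostSum V N (2 * Complex.I * ζ) 0 -
        jostSumDeriv V N (2 * Complex.I * ζ) 0 / ((γ : ℂ) - Complex.I * ζ) =
      (∑ n ∈ Finset.range (N + 1), (detCoeff γ V n : ℂ) * ((2 * Complex.I * ζ) ^ n)⁻¹) -
      (∑ m ∈ Finset.Ico 1 (N + 1), ((derivWithin (jostCoeff V m) (Set.Ici 0) 0 : ℝ) : ℂ) *
        (2 * γ) ^ (N - m)) * ((2 * Complex.I * ζ) ^ N)⁻¹ / ((γ : ℂ) - Complex.I * ζ) := by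
  set z : ℂ := 2 * Complex.I * ζ with hz
  have hz0 : z ≠ 0 := by simp [hz, hζ]
  have hz2 : z - 2 * γ = -2 * ((γ : ℂ) - Complex.I * ζ) := by rw [hz]; ring
  have hz3 : z - 2 * γ ≠ 0 := by rw [hz2]; exact mul_ne_zero (by norm_num) hγ
  have hinv : ((γ : ℂ) - Complex.I * ζ)⁻¹ = -2 * (z - 2 * γ)⁻¹ := by
    rw [hz2]; field_simp
  have hderiv : jostSumDeriv V N z 0 = ∑ m ∈ Finset.Ico 1 (N + 1),
      ((derivWithin (jostCoeff V m) (Set.Ici 0) 0 : ℝ) : ℂ) * (z ^ m)⁻¹ := by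
    rw [jostSumDeriv, Finset.range_eq_Ico, Finset.sum_eq_sum_Ico_succ_bot (by omega)]
    simp [derivWithin_jostCoeff_zero]
  have hdet : ∑ n ∈ Finset.range (N + 1), (detCoeff γ V n : ℂ) * (z ^ n)⁻¹ =
      jostSum V N z 0 + 2 * ∑ m ∈ Finset.Ico 1 (N + 1),
        ∑ n ∈ Finset.Ico (m + 1) (N + 1), ((derivWithin (jostCoeff V m) (Set.Ici 0) 0 : ℝ) : ℂ) *
          ((2 * γ) ^ (n - m - 1) * (z ^ n)⁻¹) := by
    have hswap : ∑ m ∈ Finset.Ico 1 (N + 1), ∑ n ∈ Finset.Ico (m + 1) (N + 1),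
          ((derivWithin (jostCoeff V m) (Set.Ici 0) 0 : ℝ) : ℂ) *
            ((2 * (γ : ℂ)) ^ (n - m - 1) * (z ^ n)⁻¹) =
        ∑ n ∈ Finset.range (N + 1), ∑ m ∈ Finset.Ico 1 n,
          ((derivWithin (jostCoeff V m) (Set.Ici 0) 0 : ℝ) : ℂ) *
            ((2 * (γ : ℂ)) ^ (n - m - 1) * (z ^ n)⁻¹) := by
      refine Finset.sum_comm' fun m n => ?_
      simp only [Finset.mem_Ico, Finset.mem_range]
      omega
    rw [hswap, jostSum, Finset.mul_sum, ← Finset.sum_add_distrib]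
    refine Finset.sum_congr rfl fun n _ => ?_
    rw [detCoeff_eq]
    push_cast
    rw [add_mul, mul_assoc, Finset.sum_mul]
    congr 2
    refine Finset.sum_congr rfl fun m _ => ?_
    ring
  have hexp : jostSumDeriv V N z 0 * (z - 2 * γ)⁻¹ =
      (∑ m ∈ Finset.Ico 1 (N + 1),
        ∑ n ∈ Finset.Ico (m + 1) (N + 1), ((derivWithin (jostCoeff V m) (Set.Ici 0) 0 : ℝ) : ℂ) *
          ((2 * γ) ^ (n - m - 1) * (z ^ n)⁻¹)) +
      (∑ m ∈ Finset.Ico 1 (N + 1), ((derivWithin (jostCoeff V m) (Set.Ici 0) 0 : ℝ) : ℂ) *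
        (2 * γ) ^ (N - m)) * (z ^ N)⁻¹ * (z - 2 * γ)⁻¹ := by
    rw [hderiv, Finset.sum_mul, Finset.sum_mul, Finset.sum_mul, ← Finset.sum_add_distrib]
    refine Finset.sum_congr rfl fun m hm => ?_
    rw [mul_assoc, inv_pow_mul_inv_sub_eq hz0 hz3 (Nat.lt_succ_iff.1 (Finset.mem_Ico.1 hm).2),
      ← Finset.mul_sum]
    ring
  rw [hdet, div_eq_mul_inv, div_eq_mul_inv, hinv]
  linear_combination 2 * hexp

theorem hasAsymptoticSeries_perturbationDet (γ : ℝ) {V : ℝ → ℝ} {ρ : ℝ} (hρ : 1 < ρ)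
    (hV : HasDecay ρ V) : HasAsymptoticSeries (perturbationDet γ V) (detCoeff γ V) := by
  intro N
  obtain ⟨R, C, hC⟩ := hV.exists_norm_perturbationDet_sub_le γ hρ N
  set e : ℂ := ∑ m ∈ Finset.Ico 1 (N + 1),
    ((derivWithin (jostCoeff V m) (Set.Ici 0) 0 : ℝ) : ℂ) * (2 * γ) ^ (N - m) with he
  refine Asymptotics.IsBigO.of_bound (C + 2 * ‖e‖) ?_
  filter_upwards [eventually_upperInfinity R, eventually_upperInfinity 1,
    eventually_upperInfinity (2 * |γ|)] with ζ h1 h2 h3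
  have hζpos : 0 < ‖ζ‖ := by linarith [h2.1]
  have hγn : ‖ζ‖ / 2 ≤ ‖(γ : ℂ) - Complex.I * ζ‖ := half_norm_le_norm_sub h3.1
  have hγ : (γ : ℂ) - Complex.I * ζ ≠ 0 := norm_pos_iff.1 (by linarith)
  have hD := hC ζ h1.2 h1.1
  rw [jostSum_sub_eq γ V N (norm_pos_iff.1 hζpos) hγ, ← he] at hD
  have herr : ‖e * ((2 * Complex.I * ζ) ^ N)⁻¹ / ((γ : ℂ) - Complex.I * ζ)‖ ≤
      2 * ‖e‖ * (‖ζ‖ ^ (N + 1))⁻¹ := by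
    have hz : ‖2 * Complex.I * ζ‖ = 2 * ‖ζ‖ := by simp
    rw [norm_div, norm_mul, norm_inv, norm_pow, hz]
    calc ‖e‖ * ((2 * ‖ζ‖) ^ N)⁻¹ / ‖(γ : ℂ) - Complex.I * ζ‖
        ≤ ‖e‖ * (‖ζ‖ ^ N)⁻¹ / (‖ζ‖ / 2) := by
          gcongr
          linarith
      _ = _ := by rw [pow_succ]; field_simp
  rw [Real.norm_of_nonneg (by positivity), add_mul]
  refine le_trans (le_of_eq ?_) ((norm_sub_le _ _).trans (add_le_add hD herr))
  congr 1
  ring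

/-! ### Logarithms of asymptotic series -/

/-- If the coefficients of two series satisfy the recursion equivalent to `P' = P Q'`, then
`P e^{-Q} = 1 + O(w^{N+1})` for the partial sums. -/
theorem exists_norm_sum_mul_exp_sub_one_le {a l : ℕ → ℂ} (ha : a 0 = 1) (hl : l 0 = 0)
    (hrec : ∀ k : ℕ, (k + 1) * a (k + 1) =
      ∑ i ∈ Finset.range (k + 1), a i * ((k - i : ℕ) + 1) * l (k - i + 1)) (N : ℕ) :
    ∃ M : ℝ, ∀ w : ℂ, ‖w‖ ≤ 1 →
      ‖(∑ n ∈ Finset.range (N + 1), a n * w ^ n) *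
        Complex.exp (-∑ n ∈ Finset.range (N + 1), l n * w ^ n) - 1‖ ≤ M * ‖w‖ ^ (N + 1) := by
  let P : Polynomial ℂ := ∑ n ∈ Finset.range (N + 1), Polynomial.monomial n (a n)
  let Q : Polynomial ℂ := ∑ n ∈ Finset.range (N + 1), Polynomial.monomial n (l n)
  have hPe : ∀ w, P.eval w = ∑ n ∈ Finset.range (N + 1), a n * w ^ n := fun w => by
    simp [P, Polynomial.eval_finsetSum]
  have hQe : ∀ w, Q.eval w = ∑ n ∈ Finset.range (N + 1), l n * w ^ n := fun w => by
    simp [Q, Polynomial.eval_finsetSum]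
  have hPc : ∀ n, n ≤ N → P.coeff n = a n := fun n hn => by
    simp [P, Polynomial.finsetSum_coeff, Polynomial.coeff_monomial, hn]
  have hQc : ∀ n, n ≤ N → Q.coeff n = l n := fun n hn => by
    simp [Q, Polynomial.finsetSum_coeff, Polynomial.coeff_monomial, hn]
  -- The recursion says that the coefficients of `P' - P Q'` below `N` vanish.
  have hdvd : Polynomial.X ^ N ∣ P.derivative - P * Q.derivative := by
    refine Polynomial.X_pow_dvd_iff.2 fun k hk => ?_
    rw [Polynomial.coeff_sub, Polynomial.coeff_derivative, hPc _ hk, Polynomial.coeff_mul,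
      Finset.Nat.sum_antidiagonal_eq_sum_range_succ
        (fun i j => P.coeff i * Q.derivative.coeff j), mul_comm, hrec, sub_eq_zero]
    refine Finset.sum_congr rfl fun i hi => ?_
    have hi : i < k + 1 := Finset.mem_range.1 hi
    rw [hPc i (by omega), Polynomial.coeff_derivative, hQc _ (by omega)]
    ring
  obtain ⟨S, hS⟩ := hdvd
  have hcont : Continuous fun w : ℂ => S.eval w * Complex.exp (-Q.eval w) :=
    S.continuous.mul (Complex.continuous_exp.comp Q.continuous.neg)
  obtain ⟨M, hM⟩ := (isCompact_closedBall (0 : ℂ) 1).exists_bound_of_continuousOn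
    hcont.continuousOn
  refine ⟨M, fun w hw => ?_⟩
  have hder : ∀ t : ℂ, HasDerivAt (fun t => P.eval t * Complex.exp (-Q.eval t))
      (t ^ N * (S.eval t * Complex.exp (-Q.eval t))) t := by
    intro t
    refine ((P.hasDerivAt t).mul (Q.hasDerivAt t).neg.cexp).congr_deriv ?_
    have h := congrArg (Polynomial.eval t) hS
    simp only [Polynomial.eval_sub, Polynomial.eval_mul, Polynomial.eval_pow,
      Polynomial.eval_X] at h
    linear_combination Complex.exp (-Q.eval t) * h
  have hmv := (convex_closedBall (0 : ℂ) ‖w‖).norm_image_sub_le_of_norm_hasDerivWithin_le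
    (C := ‖w‖ ^ N * M) (x := 0) (y := w)
    (fun t _ => (hder t).hasDerivWithinAt) (fun t ht => by
      have ht : ‖t‖ ≤ ‖w‖ := mem_closedBall_zero_iff.1 ht
      rw [norm_mul, norm_pow]
      have := hM t (mem_closedBall_zero_iff.2 (ht.trans hw))
      gcongr)
    (Metric.mem_closedBall_self (norm_nonneg w)) (mem_closedBall_zero_iff.2 le_rfl)
  have h0 : P.eval 0 * Complex.exp (-Q.eval 0) = 1 := by
    rw [← Polynomial.coeff_zero_eq_eval_zero, ← Polynomial.coeff_zero_eq_eval_zero,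
      hPc 0 (Nat.zero_le _), hQc 0 (Nat.zero_le _), ha, hl]
    simp
  rw [h0, sub_zero, hPe, hQe] at hmv
  exact hmv.trans (le_of_eq (by ring))

theorem norm_le_two_mul_norm_exp_sub_one {u : ℂ} (hu : ‖u‖ ≤ 1 / 2) :
    ‖u‖ ≤ 2 * ‖Complex.exp u - 1‖ := by
  have h1 := Complex.norm_exp_sub_one_sub_id_le (hu.trans (by norm_num))
  have h2 := norm_sub_le (Complex.exp u - 1) (Complex.exp u - 1 - u)
  rw [sub_sub_cancel] at h2
  nlinarith [norm_nonneg u]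

theorem tendsto_inv_upperInfinity :
    Filter.Tendsto (fun ζ : ℂ => (2 * Complex.I * ζ)⁻¹) upperInfinity (nhds 0) := by
  have h : Filter.Tendsto (fun ζ : ℂ => ζ⁻¹) upperInfinity (nhds 0) :=
    Filter.tendsto_inv₀_cobounded.mono_left inf_le_left
  have h2 := h.const_mul (2 * Complex.I)⁻¹
  rw [mul_zero] at h2
  exact h2.congr fun ζ => (mul_inv _ _).symm

theorem tendsto_norm_inv_upperInfinity :
    Filter.Tendsto (fun ζ : ℂ => ‖ζ‖⁻¹) upperInfinity (nhds 0) := by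
  have h : Filter.Tendsto (fun ζ : ℂ => ζ⁻¹) upperInfinity (nhds 0) :=
    Filter.tendsto_inv₀_cobounded.mono_left inf_le_left
  simpa using h.norm

theorem HasAsymptoticSeries.tendsto {f : ℂ → ℂ} {a : ℕ → ℝ} (h : HasAsymptoticSeries f a) :
    Filter.Tendsto f upperInfinity (nhds (a 0)) := by
  have h0 := h 0
  simp only [zero_add, Finset.range_one, Finset.sum_singleton, pow_zero, inv_one, mul_one,
    pow_one] at h0
  exact tendsto_sub_nhds_zero_iff.1 (h0.trans_tendsto tendsto_norm_inv_upperInfinity)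

/-- Logarithms of a function with an asymptotic series have an asymptotic series, with coefficients
given by the formal logarithm. -/
theorem HasAsymptoticSeries.log {D L : ℂ → ℂ} {a l : ℕ → ℝ} (hD : HasAsymptoticSeries D a)
    (hL : IsLogAtInfinity D L) (ha : a 0 = 1) (hl : l 0 = 0)
    (hrec : ∀ k : ℕ, ((k : ℝ) + 1) * a (k + 1) =
      ∑ i ∈ Finset.range (k + 1), a i * ((k - i : ℕ) + 1) * l (k - i + 1)) :
    HasAsymptoticSeries L l := by
  intro N
  obtain ⟨M, hM⟩ := exists_norm_sum_mul_exp_sub_one_le (a := fun n => (a n : ℂ))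
    (l := fun n => (l n : ℂ)) (by simp [ha]) (by simp [hl])
    (fun k => by exact_mod_cast congrArg (fun r : ℝ => (r : ℂ)) (hrec k)) N
  set P : ℂ → ℂ := fun ζ => ∑ n ∈ Finset.range (N + 1), (a n : ℂ) * ((2 * Complex.I * ζ) ^ n)⁻¹
    with hP
  set Q : ℂ → ℂ := fun ζ => ∑ n ∈ Finset.range (N + 1), (l n : ℂ) * ((2 * Complex.I * ζ) ^ n)⁻¹
    with hQ
  have hQ0 : Filter.Tendsto Q upperInfinity (nhds 0) := by
    have hc : Continuous fun w : ℂ => ∑ n ∈ Finset.range (N + 1), (l n : ℂ) * w ^ n := by fun_prop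
    have h := (hc.tendsto 0).comp tendsto_inv_upperInfinity
    have h0 : ∑ n ∈ Finset.range (N + 1), (l n : ℂ) * 0 ^ n = 0 := by
      rw [Finset.sum_range_succ']
      simp [hl]
    rw [h0] at h
    refine h.congr fun ζ => ?_
    simp only [hQ, Function.comp, inv_pow]
  have hu0 : Filter.Tendsto (fun ζ => L ζ - Q ζ) upperInfinity (nhds 0) := by
    simpa using hL.2.sub hQ0
  have hPQ : Asymptotics.IsBigO upperInfinity (fun ζ => P ζ * Complex.exp (-Q ζ) - 1)
      (fun ζ : ℂ => (‖ζ‖ ^ (N + 1))⁻¹) := by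
    refine Asymptotics.IsBigO.of_bound |M| ?_
    filter_upwards [eventually_upperInfinity 1] with ζ hζ
    have hζ1 : 1 ≤ ‖ζ‖ := hζ.1
    have hw : ‖(2 * Complex.I * ζ)⁻¹‖ ≤ ‖ζ‖⁻¹ := by
      rw [norm_inv]
      have : ‖2 * Complex.I * ζ‖ = 2 * ‖ζ‖ := by simp
      rw [this]
      gcongr
      linarith
    have h := hM (2 * Complex.I * ζ)⁻¹ (hw.trans (inv_le_one_of_one_le₀ hζ1))
    simp only [inv_pow] at h
    refine h.trans ?_
    rw [Real.norm_of_nonneg (by positivity), ← inv_pow ‖ζ‖]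
    gcongr
    exact le_abs_self M
  have hexpQ : Asymptotics.IsBigO upperInfinity (fun ζ => Complex.exp (-Q ζ))
      (fun _ => (1 : ℝ)) := by
    have h : Filter.Tendsto (fun ζ => Complex.exp (-Q ζ)) upperInfinity
        (nhds (Complex.exp (-0))) := (Complex.continuous_exp.tendsto _).comp hQ0.neg
    exact h.isBigO_one ℝ
  have hexp : Asymptotics.IsBigO upperInfinity (fun ζ => Complex.exp (L ζ - Q ζ) - 1)
      (fun ζ : ℂ => (‖ζ‖ ^ (N + 1))⁻¹) := by
    have h := ((hD N).mul hexpQ).add (by simpa using hPQ)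
    simp only [mul_one] at h
    refine h.congr' ?_ Filter.EventuallyEq.rfl
    filter_upwards [hL.1] with ζ hζ
    rw [sub_eq_add_neg (L ζ), Complex.exp_add, hζ]
    simp only [hP]
    ring
  refine Asymptotics.IsBigO.trans ?_ hexp
  refine Asymptotics.IsBigO.of_bound 2 ?_
  have hsmall : ∀ᶠ ζ in upperInfinity, ‖L ζ - Q ζ‖ < 1 / 2 :=
    (by simpa using hu0.norm : Filter.Tendsto (fun ζ => ‖L ζ - Q ζ‖) upperInfinity
      (nhds 0)).eventually_lt_const (by norm_num)
  filter_upwards [hsmall] with ζ hζ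
  exact norm_le_two_mul_norm_exp_sub_one hζ.le

theorem exists_isLogAtInfinity {D : ℂ → ℂ} (hD : Filter.Tendsto D upperInfinity (nhds 1)) :
    ∃ L : ℂ → ℂ, IsLogAtInfinity D L := by
  refine ⟨fun ζ => Complex.log (D ζ), ?_, ?_⟩
  · filter_upwards [hD.eventually_ne one_ne_zero] with ζ hζ using Complex.exp_log hζ
  · have h := hD.clog (by simp)
    rwa [Complex.log_one] at h

/-- The recursion for the `ℓₙ` as an identity between Cauchy products. -/
theorem succ_mul_detCoeff_succ (γ : ℝ) (V : ℝ → ℝ) (k : ℕ) :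
    ((k : ℝ) + 1) * detCoeff γ V (k + 1) = ∑ i ∈ Finset.range (k + 1),
      detCoeff γ V i * ((k - i : ℕ) + 1) * logDetCoeff γ V (k - i + 1) := by
  have hk : (k : ℝ) + 1 ≠ 0 := by positivity
  have h := logDetCoeff_eq γ V (k + 1)
  rw [Finset.sum_Ico_eq_sum_range, add_tsub_cancel_right] at h
  rw [Finset.sum_range_succ', ← Finset.sum_range_reflect, Nat.sub_zero, h, detCoeff_zero]
  have hsum : ∀ j ∈ Finset.range k, detCoeff γ V (k - 1 - j + 1) *
      ((k - (k - 1 - j + 1) : ℕ) + 1) * logDetCoeff γ V (k - (k - 1 - j + 1) + 1) =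
      ((1 + j : ℕ) : ℝ) * detCoeff γ V (k + 1 - (1 + j)) * logDetCoeff γ V (1 + j) := by
    intro j hj
    have hj : j < k := Finset.mem_range.1 hj
    rw [show k - (k - 1 - j + 1) = j by omega, show k - 1 - j + 1 = k + 1 - (1 + j) by omega,
      add_comm j 1]
    push_cast; ring
  rw [Finset.sum_congr rfl hsum]
  push_cast
  field_simp
  ring

end RobinHalfLine

end

theorem mainTheorem7 (γ : ℝ) (V : ℝ → ℝ)
    (hV : ContDiffOn ℝ ((⊤ : ℕ∞) : WithTop ℕ∞) V (Set.Ici 0))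
    (ρ : ℝ) (hρ : ρ ∈ Set.Ioc (1 : ℝ) 2)
    (hVbound : ∀ j : ℕ, ∃ C : ℝ, ∀ x : ℝ, 0 ≤ x →
      |iteratedDerivWithin j V (Set.Ici 0) x| ≤ C * (1 + x) ^ (-ρ - (j : ℝ))) :
    RobinHalfLine.HasAsymptoticSeries (RobinHalfLine.perturbationDet γ V)
      (RobinHalfLine.detCoeff γ V) ∧
    (∃ L : ℂ → ℂ, RobinHalfLine.IsLogAtInfinity (RobinHalfLine.perturbationDet γ V) L) ∧
    (∀ L : ℂ → ℂ, RobinHalfLine.IsLogAtInfinity (RobinHalfLine.perturbationDet γ V) L →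
      RobinHalfLine.HasAsymptoticSeries L
        (fun n => if n = 0 then 0 else RobinHalfLine.logDetCoeff γ V n)) := by
  have hdecay : RobinHalfLine.HasDecay ρ V := by
    refine ⟨hV, fun j => ?_⟩
    obtain ⟨C, hC⟩ := hVbound j
    refine ⟨|C|, fun x hx => (hC x hx).trans ?_⟩
    have h1 : (1 + x) ^ (-ρ - (j : ℝ)) ≤ (1 + x) ^ (-ρ) :=
      Real.rpow_le_rpow_of_exponent_le (by linarith) (by linarith [Nat.cast_nonneg (α := ℝ) j])
    gcongr
    exact le_abs_self C
  have hD := RobinHalfLine.hasAsymptoticSeries_perturbationDet γ hρ.1 hdecay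
  have hd0 := RobinHalfLine.detCoeff_zero γ V
  refine ⟨hD, ?_, fun L hL => ?_⟩
  · refine RobinHalfLine.exists_isLogAtInfinity ?_
    simpa [hd0] using hD.tendsto
  · refine hD.log hL hd0 (by simp) fun k => ?_
    simpa using RobinHalfLine.succ_mul_detCoeff_succ γ V k
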